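/- **Definitions.** Polynomials $A,B\in\mathbb Z[t]$ are *strongly coprime* if $(A)+(B)=\mathbb Z[t]$. A matrix $M\in SL(N,\mathbb Z)$ is *of type $\mathcal J$* if its characteristic polynomial is a product $B_0B_1\cdots B_k$ of pairwise strongly coprime integer polynomials, where $B_0$ has no real root and each $B_i$, $i\ge 1$, is irreducible and has at least one real root and at least one non-real root. Let $\alpha_1,\dots,\alpha_s$ be the distinct real eigenvalues of $M$; they are simple. A *Dirichlet family* for $M$ is a family $\mathcal D=(D_1,\dots,D_s)$ of polynomials in $\mathbb Z[t]$ such that $D_i(M)\in SL(N,\mathbb Z)$ for all $i$, $D_i(\alpha_j)>0$ for all $i,j$, and the $s$ vectors $(\log D_i(\alpha_1),\dots,\log D_i(\alpha_s))$, $1\le i\le s$, form a basis of $\mathbb R^s$. Let $G_{\mathcal D}=\mathbb Z^s\ltimes\mathbb Z^N$ be the semidirect product in which the $i$-th generator $\tau_i$ of $\mathbb Z^s$ acts on $\mathbb Z^N$ by the matrix $D_i(M^\top)$. **Theorem.** Let $M\in SL(N,\mathbb Z)$ be of type $\mathcal J$ with $s>0$ real eigenvalues $\alpha_1,\dots,\alpha_s$,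 write $N=s+2n$, and let $\mathcal D$ be a Dirichlet family for $M$. There exist: real eigenvectors $a_1,\dots,a_s\in\mathbb R^N$ of $M$ for $\alpha_1,\dots,\alpha_s$; a set $S$ containing exactly one eigenvalue from each pair of conjugate non-real eigenvalues of $M$, and no other elements; and a basis $b_1,\dots,b_n$ of the sum $W\subset\mathbb C^N$ of the generalized eigenspaces of $M$ for the eigenvalues in $S$. For any such choice let $R$ be the matrix of $M|_W$ in the basis $b_1,\dots,b_n$ and let $v_k\in\mathbb R^s\times\mathbb C^n$ ($1\le k\le N$) be the vector formed by the $k$-th coordinates of $a_1,\dots,a_s,b_1,\dots,b_n$. Let $\mathbb H\subset\mathbb C$ be the upper half-plane. Then: 1. There is an action of $G_{\mathcal D}$ on $\mathbb H^s\times\mathbb C^n$ in which $m\in\mathbb Z^N$ acts as the translation by $\sum_k m_kv_k$ and $\tau_i$ acts by $$\tau_i(w,z)=\big(D_i(\alpha_1)w_1,\dots,D_i(\alpha_s)w_s,\;D_i(R^\top)z\big).$$ It is an action by biholomorphisms, free and properly discontinuous. 2. The quotient $T(M,\mathcal D)$ is a compact (Hausdorff, second countable) complex manifold of dimension $n+s$,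 with a complex structure for which the quotient map is locally biholomorphic. 3. The map which sends the class of $(w,z)$ to $c\bmod\mathbb Z^s$, where $c\in\mathbb R^s$ is determined by $\log\operatorname{Im}w_j=\sum_i c_i\log D_i(\alpha_j)$ for $1\le j\le s$, is a locally trivial fibration $p:T(M,\mathcal D)\to\mathbb T^s=\mathbb R^s/\mathbb Z^s$ with fibre $\mathbb T^{s+2n}=\mathbb R^{s+2n}/\mathbb Z^{s+2n}$. The generators of $\pi_1(\mathbb T^s)=\mathbb Z^s$ act on the fibre by the monodromy matrices $D_1(M^\top),\dots,D_s(M^\top)$; that is, the pull-back of $p$ to the universal covering $\mathbb R^s\to\mathbb T^s$ has a global trivialization with fibre $\mathbb T^{s+2n}$ for which the deck transformation over the translation by the $i$-th unit vector $e_i$ is $(c,x)\mapsto(c+e_i,D_i(M^\top)x)$. 4. The homomorphism $\mathbb Z^s\to SL(s+2n,\mathbb Z)$ sending the $i$-th generator to $D_i(M^\top)$ is injective, so that the monodromy group is isomorphic to $\mathbb Z^s$. -/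

import Mathlib

open scoped Manifold ContDiff Polynomial

namespace GenOT

/-! ### Matrices of type `𝒥` and their spectral data -/

/-- An integer polynomial of type `𝒥`: a product `B₀ * B₁ * ⋯ * B_k` of pairwise strongly coprime
polynomials (the ideals `(A)` and `(B)` have sum `ℤ[t]`, which is `IsCoprime A B`), where `B₀` has
no real root and each `B₁, …, B_k` is irreducible with at least one real and at least one
imaginary (i.e. non-real) root. -/
def IsTypeJ (C : ℤ[X]) : Prop :=
  ∃ (B₀ : ℤ[X]) (k : ℕ) (B : Fin k → ℤ[X]),
    C = B₀ * ∏ i, B i ∧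
    (∀ x : ℝ, Polynomial.aeval x B₀ ≠ 0) ∧
    (∀ i, Irreducible (B i) ∧ (∃ x : ℝ, Polynomial.aeval x (B i) = 0) ∧
      ∃ z : ℂ, z.im ≠ 0 ∧ Polynomial.aeval z (B i) = 0) ∧
    (∀ i, IsCoprime B₀ (B i)) ∧
    Pairwise fun i j => IsCoprime (B i) (B j)

/-- A matrix in `SL(N, ℤ)` is of type `𝒥` if its characteristic polynomial is. -/
def MatrixIsTypeJ {N : ℕ} (M : Matrix.SpecialLinearGroup (Fin N) ℤ) : Prop :=
  IsTypeJ (M : Matrix (Fin N) (Fin N) ℤ).charpoly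

/-- `α₁, …, α_s` lists the real eigenvalues of `M`, each exactly once. -/
def IsRealSpectrum {N s : ℕ} (M : Matrix.SpecialLinearGroup (Fin N) ℤ) (α : Fin s → ℝ) : Prop :=
  Function.Injective α ∧
    ∀ x : ℝ, x ∈ Set.range α ↔ Polynomial.aeval x (M : Matrix (Fin N) (Fin N) ℤ).charpoly = 0

/-- `S` consists of imaginary eigenvalues of `M`, and contains exactly one member of every pair
`β, β̄` of conjugate imaginary eigenvalues. -/
def IsHalfSpectrum {N : ℕ} (M : Matrix.SpecialLinearGroup (Fin N) ℤ) (S : Set ℂ) : Prop :=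
  (∀ β ∈ S, β.im ≠ 0 ∧ Polynomial.aeval β (M : Matrix (Fin N) (Fin N) ℤ).charpoly = 0) ∧
    ∀ β : ℂ, β.im ≠ 0 → Polynomial.aeval β (M : Matrix (Fin N) (Fin N) ℤ).charpoly = 0 →
      Xor (β ∈ S) ((starRingEnd ℂ) β ∈ S)

/-- The endomorphism `f_M` of `ℂ^N` given by the matrix `M`. -/
noncomputable def complexMap {N : ℕ} (M : Matrix.SpecialLinearGroup (Fin N) ℤ) :
    Module.End ℂ (Fin N → ℂ) :=
  Matrix.toLin' ((M : Matrix (Fin N) (Fin N) ℤ).map (Int.cast : ℤ → ℂ))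

/-- The sum `W` of the generalized eigenspaces of `f_M` for the eigenvalues in `S`. -/
noncomputable def halfSpace {N : ℕ} (M : Matrix.SpecialLinearGroup (Fin N) ℤ) (S : Set ℂ) :
    Submodule ℂ (Fin N → ℂ) :=
  ⨆ β ∈ S, (complexMap M).maxGenEigenspace β

theorem mapsTo_halfSpace {N : ℕ} (M : Matrix.SpecialLinearGroup (Fin N) ℤ) (S : Set ℂ) :
    ∀ v ∈ halfSpace M S, complexMap M v ∈ halfSpace M S := by
  intro v hv
  have h : halfSpace M S ≤ (halfSpace M S).comap (complexMap M) := by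
    refine iSup₂_le fun β hβ w hw => ?_
    have h1 : (complexMap M).maxGenEigenspace β ≤ halfSpace M S :=
      le_iSup₂_of_le (f := fun β (_ : β ∈ S) => (complexMap M).maxGenEigenspace β) β hβ le_rfl
    exact h1 (Module.End.mapsTo_maxGenEigenspace_of_comm (Commute.refl (complexMap M)) β hw)
  exact h hv

/-- The choices entering the construction: real eigenvectors `a₁, …, a_s` of `M` for the real
eigenvalues `α₁, …, α_s`, a selection `S` of one eigenvalue from every conjugate pair of imaginary
eigenvalues, and a basis `b₁, …, b_n` of the corresponding space `W`. -/
structure Frame {s n : ℕ} (M : Matrix.SpecialLinearGroup (Fin (s + 2 * n)) ℤ)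
    (α : Fin s → ℝ) where
  a : Fin s → Fin (s + 2 * n) → ℝ
  a_ne_zero : ∀ j, a j ≠ 0
  a_eigen : ∀ j, ((M : Matrix (Fin (s + 2 * n)) (Fin (s + 2 * n)) ℤ).map
    (Int.cast : ℤ → ℝ)).mulVec (a j) = α j • a j
  S : Set ℂ
  isHalfSpectrum : IsHalfSpectrum M S
  b : Module.Basis (Fin n) ℂ (halfSpace M S)

namespace Frame

variable {s n : ℕ} {M : Matrix.SpecialLinearGroup (Fin (s + 2 * n)) ℤ} {α : Fin s → ℝ}

/-- The matrix `R` of the restriction of `f_M` to `W` in the basis `b₁, …, b_n`. -/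
noncomputable def R (F : Frame M α) : Matrix (Fin n) (Fin n) ℂ :=
  LinearMap.toMatrix F.b F.b ((complexMap M).restrict (mapsTo_halfSpace M F.S))

/-- The vector `v_k ∈ ℝ^s × ℂ^n ⊆ ℂ^s × ℂ^n` formed by the `k`-th coordinates of
`a₁, …, a_s, b₁, …, b_n`. -/
noncomputable def v (F : Frame M α) (k : Fin (s + 2 * n)) : (Fin s → ℂ) × (Fin n → ℂ) :=
  (fun j => (F.a j k : ℂ), fun l => (F.b l : Fin (s + 2 * n) → ℂ) k)

end Frame

/-! ### Dirichlet families -/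

/-- A family of `s` points of `(ℝ^*_+)^s` is a log-basis if the coordinatewise logarithms form a
basis of `ℝ^s`. -/
def IsLogBasis {s : ℕ} (ξ : Fin s → Fin s → ℝ) : Prop :=
  LinearIndependent ℝ (fun i j => Real.log (ξ i j)) ∧
    Submodule.span ℝ (Set.range fun i j => Real.log (ξ i j)) = ⊤

/-- A Dirichlet family for `M`, where `α` lists the real eigenvalues of `M`. -/
structure IsDirichletFamily {N s : ℕ} (M : Matrix.SpecialLinearGroup (Fin N) ℤ) (α : Fin s → ℝ)
    (D : Fin s → ℤ[X]) : Prop where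
  det_eq_one : ∀ i, (Polynomial.aeval (M : Matrix (Fin N) (Fin N) ℤ) (D i)).det = 1
  pos : ∀ i j, 0 < Polynomial.aeval (α j) (D i)
  isLogBasis : IsLogBasis fun i j => Polynomial.aeval (α j) (D i)

theorem aeval_transpose {N : ℕ} (A : Matrix (Fin N) (Fin N) ℤ) (P : ℤ[X]) :
    Polynomial.aeval A.transpose P = (Polynomial.aeval A P).transpose := by
  induction P using Polynomial.induction_on' with
  | add p q hp hq => simp [hp, hq]
  | monomial k c =>
    simp only [Polynomial.aeval_monomial, Matrix.transpose_mul, Matrix.transpose_pow]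
    rw [Matrix.algebraMap_eq_diagonal, Matrix.diagonal_transpose,
      ← Matrix.algebraMap_eq_diagonal, Algebra.commutes]

/-- The element `D_i(Mᵀ)` of `SL(N, ℤ)`. -/
noncomputable def monodromyMatrix {N s : ℕ} {M : Matrix.SpecialLinearGroup (Fin N) ℤ}
    {α : Fin s → ℝ} {D : Fin s → ℤ[X]} (hD : IsDirichletFamily M α D) (i : Fin s) :
    Matrix.SpecialLinearGroup (Fin N) ℤ :=
  ⟨Polynomial.aeval (M : Matrix (Fin N) (Fin N) ℤ).transpose (D i), by
    rw [aeval_transpose, Matrix.det_transpose, hD.det_eq_one i]⟩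

theorem commute_monodromyMatrix {N s : ℕ} {M : Matrix.SpecialLinearGroup (Fin N) ℤ}
    {α : Fin s → ℝ} {D : Fin s → ℤ[X]} (hD : IsDirichletFamily M α D) (i j : Fin s) :
    Commute (monodromyMatrix hD i) (monodromyMatrix hD j) := by
  apply Subtype.ext
  change Polynomial.aeval (M : Matrix (Fin N) (Fin N) ℤ).transpose (D i) *
      Polynomial.aeval (M : Matrix (Fin N) (Fin N) ℤ).transpose (D j) =
    Polynomial.aeval (M : Matrix (Fin N) (Fin N) ℤ).transpose (D j) *
      Polynomial.aeval (M : Matrix (Fin N) (Fin N) ℤ).transpose (D i)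
  rw [← map_mul, ← map_mul, mul_comm]

/-- The representation of (multiplicatively written) `ℤ^s` in `SL(N, ℤ)` which sends the `i`-th
generator to `D_i(Mᵀ)`. -/
noncomputable def monodromyRep {N s : ℕ} {M : Matrix.SpecialLinearGroup (Fin N) ℤ}
    {α : Fin s → ℝ} {D : Fin s → ℤ[X]} (hD : IsDirichletFamily M α D) :
    (Fin s → Multiplicative ℤ) →* Matrix.SpecialLinearGroup (Fin N) ℤ :=
  MonoidHom.noncommPiCoprod (fun i => zpowersHom _ (monodromyMatrix hD i))
    (fun i j _ x y => by
      simp only [zpowersHom_apply]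
      exact ((commute_monodromyMatrix hD i j).zpow_zpow _ _))

/-- `SL(N, ℤ)` acting on (multiplicatively written) `ℤ^N` by `m ↦ A m`. -/
def latticeAut (N : ℕ) : Matrix.SpecialLinearGroup (Fin N) ℤ →*
    MulAut (Multiplicative (Fin N → ℤ)) where
  toFun A := AddEquiv.toMultiplicative (Matrix.SpecialLinearGroup.toLin' A).toAddEquiv
  map_one' := by ext x : 1; simp
  map_mul' A B := by ext x : 1; simp

/-- The group `G_𝒟 = ℤ^s ⋉ ℤ^N`, in which the `i`-th generator of `ℤ^s` acts on `ℤ^N` by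
`D_i(Mᵀ)`. -/
def GroupD {N s : ℕ} {M : Matrix.SpecialLinearGroup (Fin N) ℤ}
    {α : Fin s → ℝ} {D : Fin s → ℤ[X]} (hD : IsDirichletFamily M α D) : Type :=
  Multiplicative (Fin N → ℤ) ⋊[(latticeAut N).comp (monodromyRep hD)] (Fin s → Multiplicative ℤ)

noncomputable instance {N s : ℕ} {M : Matrix.SpecialLinearGroup (Fin N) ℤ}
    {α : Fin s → ℝ} {D : Fin s → ℤ[X]} (hD : IsDirichletFamily M α D) : Group (GroupD hD) :=
  inferInstanceAs (Group (Multiplicative (Fin N → ℤ)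
    ⋊[(latticeAut N).comp (monodromyRep hD)] (Fin s → Multiplicative ℤ)))

/-- The `i`-th generator of `ℤ^s`, as an element of `G_𝒟`. -/
noncomputable def tau {N s : ℕ} {M : Matrix.SpecialLinearGroup (Fin N) ℤ}
    {α : Fin s → ℝ} {D : Fin s → ℤ[X]} (hD : IsDirichletFamily M α D) (i : Fin s) : GroupD hD :=
  SemidirectProduct.inr (Pi.mulSingle i (Multiplicative.ofAdd 1))

/-- The element `m` of `ℤ^N`, as an element of `G_𝒟`. -/
noncomputable def translation {N s : ℕ} {M : Matrix.SpecialLinearGroup (Fin N) ℤ}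
    {α : Fin s → ℝ} {D : Fin s → ℤ[X]} (hD : IsDirichletFamily M α D) (m : Fin N → ℤ) :
    GroupD hD :=
  SemidirectProduct.inl (Multiplicative.ofAdd m)

/-! ### The space `ℍ^s × ℂ^n` -/

/-- The open subset `ℍ^s × ℂ^n` of `ℂ^s × ℂ^n`, a complex manifold of dimension `s + n`. -/
def HC (s n : ℕ) : TopologicalSpace.Opens ((Fin s → ℂ) × (Fin n → ℂ)) where
  carrier := {x | ∀ j, 0 < (x.1 j).im}
  is_open' := by
    simp only [Set.ofPred_forall]
    exact isOpen_iInter_of_finite fun j => isOpen_lt continuous_const (by fun_prop)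

/-- A shortcut for instance search. -/
instance {N s n : ℕ} {M : Matrix.SpecialLinearGroup (Fin N) ℤ}
    {α : Fin s → ℝ} {D : Fin s → ℤ[X]} (hD : IsDirichletFamily M α D)
    [MulAction (GroupD hD) (HC s n)] : SMul (GroupD hD) (HC s n) :=
  SemigroupAction.toSMul

/-- An action of `G_𝒟` on `ℍ^s × ℂ^n` is the twisted diagonal one if `m ∈ ℤ^(s+2n)` acts as the
translation by `∑ k, m_k v_k` and the `i`-th generator of `ℤ^s` acts as
`(w, z) ↦ (D_i(α₁) w₁, …, D_i(α_s) w_s, D_i(Rᵀ) z)`. As these elements generate `G_𝒟`, there is at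
most one such action. -/
structure IsTwistedDiagonal {s n : ℕ} {M : Matrix.SpecialLinearGroup (Fin (s + 2 * n)) ℤ}
    {α : Fin s → ℝ} (F : Frame M α) {D : Fin s → ℤ[X]} (hD : IsDirichletFamily M α D)
    [MulAction (GroupD hD) (HC s n)] : Prop where
  translation_smul : ∀ (m : Fin (s + 2 * n) → ℤ) (x : HC s n),
    (translation hD m • x).1 = x.1 + ∑ k, m k • F.v k
  tau_smul : ∀ (i : Fin s) (x : HC s n),
    (tau hD i • x).1 =
      (fun j => ((Polynomial.aeval (α j) (D i) : ℝ) : ℂ) * x.1.1 j,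
        (Polynomial.aeval F.R.transpose (D i)).mulVec x.1.2)

/-- The quotient `T(M, 𝒟)` of `ℍ^s × ℂ^n` by a given action of `G_𝒟`, with the quotient topology. -/
abbrev T {s n : ℕ} {M : Matrix.SpecialLinearGroup (Fin (s + 2 * n)) ℤ}
    {α : Fin s → ℝ} {D : Fin s → ℤ[X]} (hD : IsDirichletFamily M α D)
    [MulAction (GroupD hD) (HC s n)] : Type :=
  Quotient (MulAction.orbitRel (GroupD hD) (HC s n))

/-- The quotient map `ℍ^s × ℂ^n → T(M, 𝒟)`. -/
noncomputable def toT {s n : ℕ} {M : Matrix.SpecialLinearGroup (Fin (s + 2 * n)) ℤ}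
    {α : Fin s → ℝ} {D : Fin s → ℤ[X]} (hD : IsDirichletFamily M α D)
    [MulAction (GroupD hD) (HC s n)] (x : HC s n) : T (n := n) hD :=
  Quotient.mk _ x

/-! ### Fibrations over the torus and their monodromy -/

/-- The point of `𝕋^s = (ℝ/ℤ)^s` represented by a point of `ℝ^s`. -/
def toTorus {s : ℕ} (c : Fin s → ℝ) : UnitAddTorus (Fin s) := fun i => (c i : UnitAddCircle)

/-- The automorphism of the torus `𝕋^N = ℝ^N/ℤ^N` given by an integer matrix. -/
def torusMap {N : ℕ} (A : Matrix.SpecialLinearGroup (Fin N) ℤ) (x : UnitAddTorus (Fin N)) :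
    UnitAddTorus (Fin N) :=
  fun k => ∑ l, A k l • x l

/-- `p : T → 𝕋^s` is a locally trivial fibration with fibre `F`. -/
def IsFibration {s : ℕ} {T : Type*} [TopologicalSpace T] (F : Type*) [TopologicalSpace F]
    (p : T → UnitAddTorus (Fin s)) : Prop :=
  ∀ c, ∃ e : Bundle.Trivialization F p, c ∈ e.baseSet

/-- The generators of `π₁(𝕋^s) = ℤ^s` act on the fibre `F` of `p : T → 𝕋^s` by the monodromy maps
`ρ₁, …, ρ_s`: the pull-back of `p` to the universal covering `ℝ^s → 𝕋^s` has a global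
trivialization `Θ` with fibre `F`, for which the deck transformation of the pull-back lying over
the translation by the `i`-th unit vector is `(c, x) ↦ (c + e_i, ρ_i x)`. In other words, `T` is
the quotient of `ℝ^s × F` by the group generated by these maps, and over the `i`-th coordinate
loop the total space is the mapping torus of `ρ_i`. -/
def HasMonodromy {s : ℕ} {T F : Type*} [TopologicalSpace T] [TopologicalSpace F]
    (p : T → UnitAddTorus (Fin s)) (ρ : Fin s → F → F) : Prop :=
  ∃ Θ : ((Fin s → ℝ) × F) ≃ₜ {q : (Fin s → ℝ) × T // p q.2 = toTorus q.1},
    (∀ c x, (Θ (c, x)).1.1 = c) ∧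
    ∀ i c x, (Θ (c + Pi.single i 1, ρ i x)).1.2 = (Θ (c, x)).1.2

end GenOT

/-! The theorem reduces to linear algebra: in suitable real coordinates the action is an explicit
affine action of `ℤ^s ⋉ ℤ^N` on `ℝ^s × ℝ^N`.

Type `𝒥` makes the real eigenvalues simple (`IsTypeJ.derivative_ne_zero`), so each real generalized
eigenspace is a line. A real vector orthogonal to all `a_j` and to `W` is also orthogonal to the
conjugate of `W`, hence to every generalized eigenspace, and so vanishes (`eq_zero_of_pairing`).
Therefore `dim W = n`, and `v_1, …, v_N` is a real basis of `ℝ^s × ℂ^n` (`periodEquiv`). This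
isomorphism carries `Mᵀ` to the pair of `diag(α_j)` and `Rᵀ`.

Write the logarithms of `Im w` in the log-basis as `c`, and `(Re w, z)` in the basis `v_k` as `r`. A
group element with components `t`, `m` acts by `(c, r) ↦ (c + t, ρ(t) r + m)`, where `ρ` is
`monodromyRep`. Freeness, proper discontinuity, compactness of the quotient and the torus bundle
over `𝕋^s` can all be read off this formula. Holomorphy is visible in the original coordinates,
where each element acts by a complex affine map (`exists_smul_eq`). The complex structure descends
because the quotient map is a local homeomorphism whose fibres are orbits of biholomorphisms.
Injectivity of `ρ` follows from its eigenvalues `exp (∑ t_i log D_i(α_j))` and the independence of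
the logarithms. -/

section QuotientManifold

/-! ### Manifold structures on quotients by deck transformations -/

variable {𝕜 : Type*} [NontriviallyNormedField 𝕜] {E : Type*} [NormedAddCommGroup E]
  [NormedSpace 𝕜 E] {H : Type*} [TopologicalSpace H] (I : ModelWithCorners 𝕜 E H)
  {M : Type*} [TopologicalSpace M] [ChartedSpace H M]

/-- If the `C^n` deck transformations of a local homeomorphism `f` are transitive on its fibres,
then the composition of `f` with any of its local inverses is `C^n`. -/
theorem IsLocalHomeomorph.contMDiffOn_localInverseAt_comp {Q : Type*} [TopologicalSpace Q]
    {f : M → Q} (hf : IsLocalHomeomorph f) {n : ℕ∞ω}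
    (hG : ∀ x y, f x = f y → ∃ γ : M → M, ContMDiff I I n γ ∧ γ x = y ∧ ∀ z, f (γ z) = f z)
    (x : M) :
    ContMDiffOn I I n (hf.localInverseAt x ∘ f) (f ⁻¹' (hf.localInverseAt x).source) := by
  intro y hy
  set σ := hf.localInverseAt x with hσ
  have hσf : ∀ z ∈ σ.target, σ (f z) = z := fun z hz => by
    have := σ.right_inv hz
    rwa [hσ, hf.localInverseAt_symm] at this
  have hfσ : f (σ (f y)) = f y := hf.apply_localInverseAt_of_mem hy
  -- The deck transformation carrying `y` to `σ (f y)` agrees with `σ ∘ f` near `y`: it preserves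
  -- `f` and keeps nearby points in the sheet `σ.target`.
  obtain ⟨γ, hγ, hγy, hγf⟩ := hG y (σ (f y)) hfσ.symm
  refine ContMDiffAt.contMDiffWithinAt ?_
  refine (hγ y).congr_of_eventuallyEq ?_
  have hmem : γ y ∈ σ.target := hγy ▸ σ.map_source hy
  filter_upwards [hγ.continuous.continuousAt.preimage_mem_nhds (σ.open_target.mem_nhds hmem)]
    with z hz
  rw [Function.comp_apply, ← hγf z, hσf _ hz]

/-- The target of a surjective local homeomorphism with `C^n` deck transformations that are
transitive on the fibres is a `C^n` manifold. -/
theorem IsLocalHomeomorph.isManifold_of_deck {Q : Type*} [TopologicalSpace Q] {n : ℕ∞ω}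
    [IsManifold I n M]
    {f : M → Q} (hf : IsLocalHomeomorph f) (hs : Function.Surjective f)
    (hG : ∀ x y, f x = f y → ∃ γ : M → M, ContMDiff I I n γ ∧ γ x = y ∧ ∀ z, f (γ z) = f z) :
    let := hf.chartedSpace (H := H) hs
    IsManifold I n Q := by
  let := hf.chartedSpace (H := H) hs
  refine isManifold_of_contDiffOn I n Q ?_
  rintro _ _ ⟨q, rfl⟩ ⟨q', rfl⟩
  -- A chart of `Q` is a local inverse of `f` followed by a chart of `M`; which preimage was chosen
  -- plays no role.
  generalize hs.hasRightInverse.choose q = x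
  generalize hs.hasRightInverse.choose q' = x'
  rw [← contMDiffOn_iff_contDiffOn]
  have h1 : ContMDiffOn 𝓘(𝕜, E) I n I.symm (Set.range I) := I.contMDiffOn_symm
  have h2 := contMDiffOn_chart_symm (I := I) (n := n) (x := x)
  have h3 := hf.contMDiffOn_localInverseAt_comp I hG x'
  have h4 := contMDiffOn_chart (I := I) (n := n) (x := x')
  have h5 : ContMDiff I 𝓘(𝕜, E) n I := I.contMDiff
  have := h5.comp_contMDiffOn (h4.comp' (h3.comp' (h2.comp' h1)))
  refine (this.mono ?_).congr ?_
  · rintro z ⟨hz, hzr⟩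
    simp only [OpenPartialHomeomorph.trans_source, OpenPartialHomeomorph.symm_source,
      OpenPartialHomeomorph.trans_target, OpenPartialHomeomorph.coe_trans_symm,
      Set.mem_preimage, Set.mem_inter_iff, Function.comp_apply, hf.localInverseAt_symm] at hz ⊢
    exact ⟨⟨⟨hzr, hz.1.1⟩, hz.2.1⟩, hz.2.2⟩
  · rintro z -
    simp [hf.localInverseAt_symm]

/-- The projection is then a `C^n` local diffeomorphism. -/
theorem IsLocalHomeomorph.isLocalDiffeomorph_of_deck {Q : Type*} [TopologicalSpace Q] {n : ℕ∞ω}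
    [IsManifold I n M]
    {f : M → Q} (hf : IsLocalHomeomorph f) (hs : Function.Surjective f)
    (hG : ∀ x y, f x = f y → ∃ γ : M → M, ContMDiff I I n γ ∧ γ x = y ∧ ∀ z, f (γ z) = f z) :
    let := hf.chartedSpace (H := H) hs
    IsLocalDiffeomorph I I n f := by
  let := hf.chartedSpace (H := H) hs
  have : IsManifold I n Q := hf.isManifold_of_deck I hs hG
  have hfσ : ∀ x, ∀ q ∈ (hf.localInverseAt x).source, f (hf.localInverseAt x q) = q :=
    fun x q hq => hf.apply_localInverseAt_of_mem hq
  set g : Q → M := hs.hasRightInverse.choose with hg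
  have hgq : ∀ q, f (g q) = q := hs.hasRightInverse.choose_spec
  have hchart : ∀ q : Q, chartAt H q = (hf.localInverseAt (g q)).trans (chartAt H (g q)) :=
    fun q => rfl
  have hmk : ContMDiff I I n f := by
    intro x
    have hq : f x ∈ (hf.localInverseAt (g (f x))).source := by
      have h := hf.apply_self_mem_localInverseAt_source (x := g (f x))
      rwa [hgq] at h
    set σ := hf.localInverseAt (g (f x)) with hσ
    -- Near `x`, `f` is `σ ∘ f`, then a chart of `M`, then the inverse of the corresponding chart of
    -- `Q`.
    have h1 := (contMDiffOn_chart_symm (I := I) (n := n) (x := f x)).comp'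
      ((contMDiffOn_chart (I := I) (n := n) (x := g (f x))).comp'
      (hf.contMDiffOn_localInverseAt_comp I hG (g (f x))))
    have hself : σ (f x) ∈ (chartAt H (g (f x))).source := by
      have h := mem_chart_source H (f x)
      rw [hchart, OpenPartialHomeomorph.trans_source] at h
      exact h.2
    have hev : ∀ᶠ z in nhds x, f z ∈ σ.source ∧ σ (f z) ∈ (chartAt H (g (f x))).source := by
      have h := (chartAt H (f x)).open_source.mem_nhds (mem_chart_source H (f x))
      filter_upwards [hf.continuous.continuousAt.preimage_mem_nhds h] with z hz
      rw [hchart, Set.mem_preimage, OpenPartialHomeomorph.trans_source] at hz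
      exact hz
    refine (h1.contMDiffAt ?_).congr_of_eventuallyEq ?_
    · filter_upwards [hev] with z hz
      refine ⟨⟨hz.1, hz.2⟩, ?_⟩
      change (chartAt H (f x)) (f z) ∈ (chartAt H (f x)).target
      refine (chartAt H (f x)).map_source ?_
      rw [hchart, OpenPartialHomeomorph.trans_source]
      exact hz
    · filter_upwards [hev] with z hz
      change f z = (chartAt H (f x)).symm ((chartAt H (f x)) (f z))
      refine ((chartAt H (f x)).left_inv ?_).symm
      rw [hchart, OpenPartialHomeomorph.trans_source]
      exact hz
  change IsLocalDiffeomorph I I n f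
  intro x
  refine ⟨⟨(hf.localInverseAt x).symm.toPartialEquiv, (hf.localInverseAt x).open_target,
    (hf.localInverseAt x).open_source, ?_, ?_⟩, hf.self_mem_localInverseAt_target, ?_⟩
  · exact hmk.contMDiffOn.congr fun z _ => congrFun (hf.localInverseAt_symm x) z
  · intro q hq
    refine ContMDiffAt.contMDiffWithinAt ?_
    change ContMDiffAt I I n (hf.localInverseAt x) q
    -- The chart of `Q` followed by the inverse chart of `M` is a local section of `f`, so the local
    -- inverse at `x` factors through the composition with `f` already treated.
    have h1 := (hf.contMDiffOn_localInverseAt_comp I hG x).comp'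
      ((contMDiffOn_chart_symm (I := I) (n := n) (x := g q)).comp'
      (contMDiffOn_chart (I := I) (n := n) (x := q)))
    have hev : ∀ᶠ p in nhds q, p ∈ (chartAt H q).source ∧ p ∈ (hf.localInverseAt x).source :=
      Filter.Eventually.and ((chartAt H q).open_source.mem_nhds (mem_chart_source H q))
        ((hf.localInverseAt x).open_source.mem_nhds hq)
    have key : ∀ p ∈ (chartAt H q).source,
        (chartAt H q) p ∈ (chartAt H (g q)).target ∧
          f ((chartAt H (g q)).symm ((chartAt H q) p)) = p := by
      intro p hp
      rw [hchart, OpenPartialHomeomorph.trans_source] at hp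
      rw [hchart, OpenPartialHomeomorph.coe_trans, Function.comp_apply]
      refine ⟨(chartAt H (g q)).map_source hp.2, ?_⟩
      rw [(chartAt H (g q)).left_inv hp.2, hfσ _ _ hp.1]
    refine (h1.contMDiffAt ?_).congr_of_eventuallyEq ?_
    · filter_upwards [hev] with p hp
      refine ⟨⟨hp.1, (key p hp.1).1⟩, ?_⟩
      simp only [Set.mem_preimage, Function.comp_apply, (key p hp.1).2]
      exact hp.2
    · filter_upwards [hev] with p hp
      simp only [Function.comp_apply, (key p hp.1).2]
  · intro z _
    exact (congrFun (hf.localInverseAt_symm x) z).symm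

end QuotientManifold

/-! ### Simplicity of the real eigenvalues and the dimension of `W` -/

namespace GenOT

/-- The real roots of a polynomial of type `𝒥` are simple. -/
theorem IsTypeJ.derivative_ne_zero {C : ℤ[X]} (hC : IsTypeJ C) {x : ℝ}
    (hx : Polynomial.aeval x C = 0) : Polynomial.aeval x (Polynomial.derivative C) ≠ 0 := by
  obtain ⟨B₀, k, B, rfl, h0, hB, h0B, hBB⟩ := hC
  rw [map_mul, map_prod, mul_eq_zero, or_iff_right (h0 x), Finset.prod_eq_zero_iff] at hx
  obtain ⟨i, -, hi⟩ := hx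
  obtain ⟨hirr, -, -⟩ := hB i
  -- A Bézout identity evaluated at a common root would read `0 = 1`; thus `x` is a root of `B i`
  -- alone.
  have hcop : ∀ P : ℤ[X], IsCoprime P (B i) → Polynomial.aeval x P ≠ 0 := by
    rintro P ⟨u, v, huv⟩ hP
    have := congrArg (Polynomial.aeval x) huv
    simp [hP, hi] at this
  have hdeg : (B i).natDegree ≠ 0 := by
    intro h
    rw [Polynomial.eq_C_of_natDegree_eq_zero h] at hi
    simp only [eq_intCast, map_intCast, Int.cast_eq_zero] at hi
    exact hirr.ne_zero (by rw [Polynomial.eq_C_of_natDegree_eq_zero h, hi, map_zero])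
  -- By Gauss's lemma `B i` stays irreducible over `ℚ`, hence is separable in characteristic zero.
  have hsep : ((B i).map (Int.castRingHom ℚ)).Separable :=
    ((Polynomial.IsPrimitive.Int.irreducible_iff_irreducible_map_cast
      (hirr.isPrimitive hdeg)).1 hirr).separable
  have hd : Polynomial.aeval x (Polynomial.derivative (B i)) ≠ 0 := by
    obtain ⟨u, v, huv⟩ := hsep
    intro h
    rw [Polynomial.derivative_map] at huv
    have h2 : ∀ P : ℤ[X], Polynomial.aeval x (P.map (Int.castRingHom ℚ)) = Polynomial.aeval x P :=
      fun P => Polynomial.aeval_map_algebraMap (R := ℤ) ℚ x P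
    have := congrArg (Polynomial.aeval x) huv
    simp [h2, h, hi] at this
  have hQ : B₀ * ∏ j, B j = B i * (B₀ * ∏ j ∈ Finset.univ.erase i, B j) := by
    rw [← Finset.mul_prod_erase Finset.univ B (Finset.mem_univ i)]; ring
  rw [hQ, Polynomial.derivative_mul, map_add, map_mul, map_mul (Polynomial.aeval x) (B i), hi,
    zero_mul, add_zero]
  refine mul_ne_zero hd (hcop _ (IsCoprime.mul_left (h0B i) (IsCoprime.prod_left ?_)))
  exact fun j hj => hBB (Finset.ne_of_mem_erase hj)

section Spectrum

variable {N : ℕ} (M : Matrix.SpecialLinearGroup (Fin N) ℤ)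

theorem charpoly_complexMap :
    (complexMap M).charpoly =
      (M : Matrix (Fin N) (Fin N) ℤ).charpoly.map (Int.castRingHom ℂ) := by
  rw [complexMap, Matrix.charpoly_toLin', ← Matrix.charpoly_map]
  rfl

theorem finrank_maxGenEigenspace_complexMap (β : ℂ) :
    Module.finrank ℂ ((complexMap M).maxGenEigenspace β) =
      ((M : Matrix (Fin N) (Fin N) ℤ).charpoly.map (Int.castRingHom ℂ)).rootMultiplicity β := by
  rw [LinearMap.finrank_maxGenEigenspace_eq, charpoly_complexMap]

theorem maxGenEigenspace_complexMap_eq_bot {β : ℂ}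
    (hβ : Polynomial.aeval β (M : Matrix (Fin N) (Fin N) ℤ).charpoly ≠ 0) :
    (complexMap M).maxGenEigenspace β = ⊥ := by
  rw [← Submodule.finrank_eq_zero (R := ℂ), finrank_maxGenEigenspace_complexMap]
  refine Polynomial.rootMultiplicity_eq_zero ?_
  rw [Polynomial.IsRoot, Polynomial.eval_map]
  exact hβ

theorem aeval_ofReal (P : ℤ[X]) (x : ℝ) :
    Polynomial.aeval (x : ℂ) P = ((Polynomial.aeval x P : ℝ) : ℂ) := by
  exact Polynomial.aeval_algebraMap_apply ℂ x P

/-- The dimension is the multiplicity of `x` in the characteristic polynomial. Type `𝒥` enters the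
linear algebra only through this lemma. -/
theorem finrank_maxGenEigenspace_real (hM : MatrixIsTypeJ M) {x : ℝ}
    (hx : Polynomial.aeval x (M : Matrix (Fin N) (Fin N) ℤ).charpoly = 0) :
    Module.finrank ℂ ((complexMap M).maxGenEigenspace x) = 1 := by
  rw [finrank_maxGenEigenspace_complexMap]
  set C := (M : Matrix (Fin N) (Fin N) ℤ).charpoly with hC
  have h0 : C.map (Int.castRingHom ℂ) ≠ 0 := ((Matrix.charpoly_monic _).map _).ne_zero
  have h1 : 0 < (C.map (Int.castRingHom ℂ)).rootMultiplicity (x : ℂ) := by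
    rw [Polynomial.rootMultiplicity_pos h0, Polynomial.IsRoot, Polynomial.eval_map]
    change Polynomial.aeval (x : ℂ) C = 0
    rw [aeval_ofReal, hx, Complex.ofReal_zero]
  have h2 : ¬ 1 < (C.map (Int.castRingHom ℂ)).rootMultiplicity (x : ℂ) := by
    rw [Polynomial.one_lt_rootMultiplicity_iff_isRoot h0]
    rintro ⟨-, h⟩
    rw [Polynomial.derivative_map, Polynomial.IsRoot, Polynomial.eval_map] at h
    change Polynomial.aeval (x : ℂ) (Polynomial.derivative C) = 0 at h
    rw [aeval_ofReal, Complex.ofReal_eq_zero] at h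
    exact IsTypeJ.derivative_ne_zero hM hx h
  omega

theorem complexMap_star (v : Fin N → ℂ) : complexMap M (star v) = star (complexMap M v) := by
  ext k
  simp [complexMap, Matrix.mulVec, dotProduct]

/-- The entries of `M` are real, so conjugation turns `(M - β)^k` into `(M - β̄)^k`. -/
theorem star_mem_maxGenEigenspace {β : ℂ} {v : Fin N → ℂ}
    (hv : v ∈ (complexMap M).maxGenEigenspace β) :
    star v ∈ (complexMap M).maxGenEigenspace ((starRingEnd ℂ) β) := by
  rw [Module.End.mem_maxGenEigenspace] at hv ⊢
  obtain ⟨k, hk⟩ := hv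
  refine ⟨k, ?_⟩
  suffices h : ∀ w : Fin N → ℂ,
      ((complexMap M - (starRingEnd ℂ) β • (1 : Module.End ℂ (Fin N → ℂ))) ^ k) (star w) =
        star (((complexMap M - β • (1 : Module.End ℂ (Fin N → ℂ))) ^ k) w) by
    rw [h, hk, star_zero]
  clear hk
  induction k with
  | zero => simp
  | succ k ih =>
    intro w
    rw [pow_succ, pow_succ, Module.End.mul_apply, Module.End.mul_apply, ← ih]
    congr 1
    simp [complexMap_star, star_smul]

/-- The pairing with a real vector, as a linear functional on `ℂ^N`. -/
noncomputable def pairing (r : Fin N → ℝ) : (Fin N → ℂ) →ₗ[ℂ] ℂ :=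
  ∑ k, (r k : ℂ) • LinearMap.proj k

theorem pairing_apply (r : Fin N → ℝ) (w : Fin N → ℂ) : pairing r w = ∑ k, (r k : ℂ) * w k := by
  simp [pairing]

theorem pairing_star (r : Fin N → ℝ) (w : Fin N → ℂ) : pairing r (star w) = star (pairing r w) := by
  simp [pairing_apply]

theorem maxGenEigenspace_le_halfSpace {S : Set ℂ} {β : ℂ} (hβ : β ∈ S) :
    (complexMap M).maxGenEigenspace β ≤ halfSpace M S :=
  le_iSup₂_of_le (f := fun β (_ : β ∈ S) => (complexMap M).maxGenEigenspace β) β hβ le_rfl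

variable {s : ℕ} {α : Fin s → ℝ}

theorem ofReal_eigenvector {a : Fin N → ℝ} {x : ℝ}
    (ha : ((M : Matrix (Fin N) (Fin N) ℤ).map (Int.cast : ℤ → ℝ)).mulVec a = x • a) :
    complexMap M (fun k => (a k : ℂ)) = (x : ℂ) • fun k => (a k : ℂ) := by
  ext k
  have := congrArg (Complex.ofReal) (congrFun ha k)
  simpa [complexMap, Matrix.mulVec, dotProduct] using this

theorem ofReal_mem_maxGenEigenspace {a : Fin N → ℝ} {x : ℝ}
    (ha : ((M : Matrix (Fin N) (Fin N) ℤ).map (Int.cast : ℤ → ℝ)).mulVec a = x • a) :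
    (fun k => (a k : ℂ)) ∈ (complexMap M).maxGenEigenspace x :=
  (complexMap M).genEigenspace_le_maximal x 1 (by
    refine Module.End.mem_eigenspace_iff.2 ?_
    exact ofReal_eigenvector M ha)

variable {M}

/-- A real vector orthogonal to the real eigenvectors and to the half space vanishes. -/
theorem eq_zero_of_pairing (hM : MatrixIsTypeJ M) (hα : IsRealSpectrum M α)
    {a : Fin s → Fin N → ℝ} (ha0 : ∀ j, a j ≠ 0)
    (ha : ∀ j, ((M : Matrix (Fin N) (Fin N) ℤ).map (Int.cast : ℤ → ℝ)).mulVec (a j) = α j • a j)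
    {S : Set ℂ} (hS : IsHalfSpectrum M S) {r : Fin N → ℝ}
    (h1 : ∀ j, ∑ k, r k * a j k = 0) (h2 : ∀ w ∈ halfSpace M S, pairing r w = 0) : r = 0 := by
  -- For real `β` the space is the line through `a_j`. For non-real `β` either `β` or its conjugate
  -- is in `S`; in the second case conjugate `w`, using that `r` is real.
  have key : ∀ β, (complexMap M).maxGenEigenspace β ≤ LinearMap.ker (pairing r) := by
    intro β
    by_cases hβ : Polynomial.aeval β (M : Matrix (Fin N) (Fin N) ℤ).charpoly = 0
    swap
    · rw [maxGenEigenspace_complexMap_eq_bot M hβ]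
      exact bot_le
    intro w hw
    rw [LinearMap.mem_ker]
    by_cases him : β.im = 0
    · obtain ⟨x, rfl⟩ : ∃ x : ℝ, (x : ℂ) = β := ⟨β.re, Complex.ext (by simp) (by simp [him])⟩
      have hx : Polynomial.aeval x (M : Matrix (Fin N) (Fin N) ℤ).charpoly = 0 := by
        rwa [aeval_ofReal, Complex.ofReal_eq_zero] at hβ
      obtain ⟨j, rfl⟩ := (hα.2 x).2 hx
      have hmem := ofReal_mem_maxGenEigenspace M (ha j)
      have hne : (⟨_, hmem⟩ : (complexMap M).maxGenEigenspace (α j : ℂ)) ≠ 0 := by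
        intro h
        refine ha0 j (funext fun k => ?_)
        exact Complex.ofReal_eq_zero.1 (congrFun (congrArg Subtype.val h) k)
      obtain ⟨c, hc⟩ := (finrank_eq_one_iff_of_nonzero' _ hne).1
        (finrank_maxGenEigenspace_real M hM hx) ⟨w, hw⟩
      have hc' : c • (fun k => (a j k : ℂ)) = w := congrArg Subtype.val hc
      have h3 : pairing r (fun k => (a j k : ℂ)) = 0 := by
        rw [pairing_apply]
        exact_mod_cast congrArg Complex.ofReal (h1 j)
      rw [← hc', map_smul, h3, smul_zero]
    · rcases hS.2 β him hβ with ⟨h, -⟩ | ⟨h, -⟩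
      · exact h2 w (maxGenEigenspace_le_halfSpace M h hw)
      · have := h2 _ (maxGenEigenspace_le_halfSpace M h (star_mem_maxGenEigenspace M hw))
        rwa [pairing_star, star_eq_zero] at this
  have htop : LinearMap.ker (pairing r) = ⊤ :=
    top_le_iff.1 ((Module.End.iSup_maxGenEigenspace_eq_top (complexMap M)) ▸ iSup_le key)
  ext k
  have : pairing r (Pi.single k 1) = 0 := by
    rw [← LinearMap.mem_ker, htop]; trivial
  simpa [pairing_apply, Pi.single_apply] using this

theorem exists_real_eigenvector {x : ℝ}
    (hx : Polynomial.aeval x (M : Matrix (Fin N) (Fin N) ℤ).charpoly = 0) :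
    ∃ a : Fin N → ℝ, a ≠ 0 ∧
      ((M : Matrix (Fin N) (Fin N) ℤ).map (Int.cast : ℤ → ℝ)).mulVec a = x • a := by
  set A := (M : Matrix (Fin N) (Fin N) ℤ).map (Int.cast : ℤ → ℝ) with hA
  have hroot : A.charpoly.IsRoot x := by
    have : A.charpoly = (M : Matrix (Fin N) (Fin N) ℤ).charpoly.map (Int.castRingHom ℝ) := by
      rw [← Matrix.charpoly_map]; rfl
    rw [this, Polynomial.IsRoot, Polynomial.eval_map]
    exact hx
  have h2 : Module.End.HasEigenvalue (Matrix.toLin' A) x := by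
    rw [Module.End.hasEigenvalue_iff_isRoot_charpoly, Matrix.charpoly_toLin']
    exact hroot
  obtain ⟨v, hv⟩ := h2.exists_hasEigenvector
  exact ⟨v, hv.2, by simpa using hv.apply_eq_smul⟩

/-- The real eigenvectors and twice the real parts of the elements of the half space are in direct
sum. -/
theorem eq_zero_of_sum_add_re (hα : IsRealSpectrum M α)
    {a : Fin s → Fin N → ℝ} (ha0 : ∀ j, a j ≠ 0)
    (ha : ∀ j, ((M : Matrix (Fin N) (Fin N) ℤ).map (Int.cast : ℤ → ℝ)).mulVec (a j) = α j • a j)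
    {S : Set ℂ} (hS : IsHalfSpectrum M S) {c : Fin s → ℝ} {w : Fin N → ℂ}
    (hw : w ∈ halfSpace M S) (h : ∀ k, ∑ j, c j * a j k + 2 * (w k).re = 0) :
    c = 0 ∧ w = 0 := by
  have hcompl : ∀ β ∉ S, (complexMap M).maxGenEigenspace β ≤ halfSpace M Sᶜ :=
    fun β hβ => maxGenEigenspace_le_halfSpace M (Set.mem_compl hβ)
  have hstar : star w ∈ halfSpace M Sᶜ := by
    refine Submodule.iSup_induction' (p := fun β => ⨆ (_ : β ∈ S), (complexMap M).maxGenEigenspace β)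
      (motive := fun v _ => star v ∈ halfSpace M Sᶜ) ?_ (by simp) ?_ hw
    · intro β v hv
      by_cases hβ : β ∈ S
      · simp only [hβ, iSup_pos] at hv
        refine hcompl _ ?_ (star_mem_maxGenEigenspace M hv)
        obtain ⟨him, hr⟩ := hS.1 β hβ
        rcases hS.2 β him hr with ⟨-, h⟩ | ⟨-, h⟩
        · exact h
        · exact absurd hβ h
      · simp only [hβ, iSup_false, Submodule.mem_bot] at hv
        simp [hv]
    · intro u v _ _ hu hv
      rw [star_add]
      exact add_mem hu hv
  have hsum : (∑ j, (c j : ℂ) • fun k => (a j k : ℂ)) ∈ halfSpace M Sᶜ := by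
    refine Submodule.sum_mem _ fun j _ => Submodule.smul_mem _ _ ?_
    refine hcompl _ (fun hj => ?_) (ofReal_mem_maxGenEigenspace M (ha j))
    exact (hS.1 _ hj).1 (Complex.ofReal_im _)
  -- The hypothesis reads `∑ c_j a_j + w + w̄ = 0`, which places `w` in the sum of generalized
  -- eigenspaces outside `S` as well; the two sums are disjoint.
  have hrel : w = -((∑ j, (c j : ℂ) • fun k => (a j k : ℂ)) + star w) := by
    ext k
    have h1 : ((∑ j, c j * a j k + 2 * (w k).re : ℝ) : ℂ) = 0 := by rw [h k]; simp
    have h2 : w k + star (w k) = ((2 * (w k).re : ℝ) : ℂ) := Complex.add_conj _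
    simp only [Pi.neg_apply, Pi.add_apply, Finset.sum_apply, Pi.smul_apply, smul_eq_mul,
      Pi.star_apply]
    push_cast at h1 h2
    linear_combination h1 + h2
  have hdisj : Disjoint (halfSpace M S) (halfSpace M Sᶜ) :=
    (complexMap M).independent_maxGenEigenspace.disjoint_biSup_biSup disjoint_compl_right
  have hw0 : w = 0 := by
    refine Submodule.disjoint_def.1 hdisj w hw ?_
    rw [hrel]
    exact neg_mem (add_mem hsum hstar)
  refine ⟨?_, hw0⟩
  have hli : LinearIndependent ℝ a :=
    Module.End.eigenvectors_linearIndependent'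
      (Matrix.toLin' ((M : Matrix (Fin N) (Fin N) ℤ).map (Int.cast : ℤ → ℝ))) α hα.1 a
      fun j => ⟨by
        rw [Module.End.mem_eigenspace_iff, Matrix.toLin'_apply]
        exact ha j, ha0 j⟩
  rw [Fintype.linearIndependent_iff] at hli
  refine funext (hli c ?_)
  ext k
  simpa [hw0] using h k

end Spectrum

variable {s n : ℕ} {M : Matrix.SpecialLinearGroup (Fin (s + 2 * n)) ℤ} {α : Fin s → ℝ}

/-- Two real dimension counts. The injection `(c, w) ↦ ∑ c_j a_j + w + w̄` from `ℝ^s × W` to `ℝ^N`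
gives `dim W ≤ n`; pairing real vectors with the `a_j` and a basis of `W` is injective on `ℝ^N` and
gives `n ≤ dim W`. -/
theorem finrank_halfSpace (hM : MatrixIsTypeJ M) (hα : IsRealSpectrum M α)
    {S : Set ℂ} (hS : IsHalfSpectrum M S) : Module.finrank ℂ (halfSpace M S) = n := by
  choose a ha0 ha using fun j => exists_real_eigenvector ((hα.2 (α j)).1 ⟨j, rfl⟩)
  have hreal := finrank_real_of_complex (halfSpace M S)
  refine le_antisymm ?_ ?_
  · let f : ((Fin s → ℝ) × halfSpace M S) →ₗ[ℝ] (Fin (s + 2 * n) → ℝ) :=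
      { toFun := fun p k => ∑ j, p.1 j * a j k + 2 * ((p.2 : Fin (s + 2 * n) → ℂ) k).re
        map_add' := fun p q => by
          ext k
          simp only [Prod.fst_add, Prod.snd_add, Pi.add_apply, add_mul, Finset.sum_add_distrib,
            Submodule.coe_add, Complex.add_re]
          ring
        map_smul' := fun x p => by
          ext k
          have h : ((x • p.2 : halfSpace M S) : Fin (s + 2 * n) → ℂ) k =
            (x : ℂ) * (p.2 : Fin (s + 2 * n) → ℂ) k := rfl
          simp only [Prod.smul_fst, Prod.smul_snd, Pi.smul_apply, smul_eq_mul, RingHom.id_apply,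
            h, Complex.re_ofReal_mul, mul_add, Finset.mul_sum, mul_assoc]
          ring }
    have hf : Function.Injective f := by
      rw [← LinearMap.ker_eq_bot, LinearMap.ker_eq_bot']
      rintro ⟨c, w⟩ h
      obtain ⟨h1, h2⟩ := eq_zero_of_sum_add_re hα ha0 ha hS w.2 (congrFun h)
      exact Prod.ext h1 (Subtype.ext h2)
    have := LinearMap.finrank_le_finrank_of_injective hf
    rw [Module.finrank_prod, hreal, Module.finrank_fin_fun, Module.finrank_fin_fun] at this
    omega
  · let b := Module.finBasis ℂ (halfSpace M S)
    let f : (Fin (s + 2 * n) → ℝ) →ₗ[ℝ]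
        ((Fin s → ℝ) × (Fin (Module.finrank ℂ (halfSpace M S)) → ℂ)) :=
      { toFun := fun r => (fun j => ∑ k, r k * a j k, fun l => pairing r (b l))
        map_add' := fun p q => by
          ext k <;> simp [pairing_apply, add_mul, Finset.sum_add_distrib]
        map_smul' := fun x p => by
          ext k <;> simp [pairing_apply, Finset.mul_sum, mul_assoc] }
    have hf : Function.Injective f := by
      rw [← LinearMap.ker_eq_bot, LinearMap.ker_eq_bot']
      intro r h
      refine eq_zero_of_pairing hM hα ha0 ha hS (congrFun (congrArg Prod.fst h)) ?_
      intro w hw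
      have hle : halfSpace M S ≤ LinearMap.ker (pairing r) := by
        have h3 : (pairing r).comp (halfSpace M S).subtype = 0 :=
          b.ext (congrFun (congrArg Prod.snd h))
        intro w hw
        exact LinearMap.congr_fun h3 ⟨w, hw⟩
      exact hle hw
    have := LinearMap.finrank_le_finrank_of_injective hf
    rw [Module.finrank_prod, finrank_real_of_complex, Module.finrank_fin_fun,
      Module.finrank_fin_fun, Module.finrank_fin_fun] at this
    omega

theorem isHalfSpectrum_upper {N : ℕ} (M : Matrix.SpecialLinearGroup (Fin N) ℤ) :
    IsHalfSpectrum M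
      {β | 0 < β.im ∧ Polynomial.aeval β (M : Matrix (Fin N) (Fin N) ℤ).charpoly = 0} := by
  refine ⟨fun β hβ => ⟨hβ.1.ne', hβ.2⟩, fun β him hβ => ?_⟩
  have hconj : Polynomial.aeval ((starRingEnd ℂ) β) (M : Matrix (Fin N) (Fin N) ℤ).charpoly = 0 := by
    have := Polynomial.aeval_algHom_apply ((Complex.conjAe : ℂ →ₐ[ℝ] ℂ).restrictScalars ℤ) β
      (M : Matrix (Fin N) (Fin N) ℤ).charpoly
    rw [hβ, map_zero] at this
    exact this
  rcases lt_or_gt_of_ne him with h | h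
  · exact Or.inr ⟨⟨by simpa using h, hconj⟩, fun h' => lt_asymm h h'.1⟩
  · exact Or.inl ⟨⟨h, hβ⟩, fun h' => lt_asymm h (by simpa using h'.1)⟩

theorem Frame.nonempty (hM : MatrixIsTypeJ M) (hα : IsRealSpectrum M α) :
    Nonempty (Frame M α) := by
  choose a ha0 ha using fun j => exists_real_eigenvector ((hα.2 (α j)).1 ⟨j, rfl⟩)
  exact ⟨⟨a, ha0, ha, _, isHalfSpectrum_upper M,
    Module.finBasisOfFinrankEq ℂ _ (finrank_halfSpace hM hα (isHalfSpectrum_upper M))⟩⟩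

end GenOT

/-! ### The period isomorphism and its equivariance -/

namespace GenOT

/-- The linear automorphism of `ℝ^N` given by an integer matrix. -/
noncomputable def realMap {N : ℕ} : Matrix (Fin N) (Fin N) ℤ →+* Module.End ℝ (Fin N → ℝ) :=
  (Matrix.toLinAlgEquiv' (R := ℝ) (n := Fin N)).toRingEquiv.toRingHom.comp
    (Int.castRingHom ℝ).mapMatrix

theorem realMap_apply {N : ℕ} (A : Matrix (Fin N) (Fin N) ℤ) (r : Fin N → ℝ) (k : Fin N) :
    realMap A r k = ∑ l, (A k l : ℝ) * r l := by
  simp [realMap, Matrix.mulVec, dotProduct]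

theorem realMap_intCast {N : ℕ} (A : Matrix (Fin N) (Fin N) ℤ) (m : Fin N → ℤ) :
    realMap A (fun k => (m k : ℝ)) = fun k => ((A.mulVec m k : ℤ) : ℝ) := by
  ext k
  simp [realMap_apply, Matrix.mulVec, dotProduct]

/-- A map intertwining an integer matrix with an operator intertwines polynomials in them. -/
theorem map_realMap_aeval {N : ℕ} {A₀ Z : Type*} [Ring A₀] [AddCommGroup Z] [Module A₀ Z]
    (f : (Fin N → ℝ) →+ Z) (A : Matrix (Fin N) (Fin N) ℤ) (B : A₀)
    (h : ∀ r, f (realMap A r) = B • f r) (P : ℤ[X]) (r : Fin N → ℝ) :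
    f (realMap (Polynomial.aeval A P) r) = Polynomial.aeval B P • f r := by
  have hpow : ∀ (k : ℕ) r, f (realMap (A ^ k) r) = B ^ k • f r := by
    intro k
    induction k with
    | zero => simp
    | succ k ih =>
      intro r
      rw [pow_succ, map_mul, Module.End.mul_apply, ih, h, smul_smul, pow_succ]
  induction P using Polynomial.induction_on' with
  | add p q hp hq => simp [map_add, add_smul, hp, hq]
  | monomial k c =>
    simp only [Polynomial.aeval_monomial, eq_intCast, map_mul, map_intCast,
      Module.End.mul_apply]
    rw [mul_smul, ← hpow, Module.End.intCast_apply, Int.cast_smul_eq_zsmul, map_zsmul]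

theorem monodromyRep_mulSingle {N s : ℕ} {M : Matrix.SpecialLinearGroup (Fin N) ℤ}
    {α : Fin s → ℝ} {D : Fin s → ℤ[X]} (hD : IsDirichletFamily M α D) (i : Fin s) :
    monodromyRep hD (Pi.mulSingle i (Multiplicative.ofAdd 1)) = monodromyMatrix hD i := by
  refine (MonoidHom.noncommPiCoprod_mulSingle _ i _).trans ?_
  simp

namespace Frame

variable {s n : ℕ} {M : Matrix.SpecialLinearGroup (Fin (s + 2 * n)) ℤ} {α : Fin s → ℝ}
  (F : Frame M α)

/-- The map `ℝ^(s+2n) → ℝ^s × ℂ^n` sending the standard basis to `v₁, …, v_N`. -/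
noncomputable def period : (Fin (s + 2 * n) → ℝ) →ₗ[ℝ] (Fin s → ℝ) × (Fin n → ℂ) where
  toFun r := (fun j => ∑ k, r k * F.a j k, fun l => pairing r (F.b l))
  map_add' p q := by
    ext k <;> simp [pairing_apply, add_mul, Finset.sum_add_distrib]
  map_smul' x p := by
    ext k <;> simp [pairing_apply, Finset.mul_sum, mul_assoc]

theorem period_fst (r : Fin (s + 2 * n) → ℝ) (j : Fin s) :
    (F.period r).1 j = ∑ k, r k * F.a j k := rfl

theorem period_snd (r : Fin (s + 2 * n) → ℝ) (l : Fin n) :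
    (F.period r).2 l = pairing r (F.b l) := rfl

theorem sum_smul_v (m : Fin (s + 2 * n) → ℤ) :
    ∑ k, m k • F.v k =
      (fun j => (((F.period fun k => (m k : ℝ)).1 j : ℝ) : ℂ),
        (F.period fun k => (m k : ℝ)).2) := by
  ext j
  · simp [v, period_fst, Prod.fst_sum, Finset.sum_apply]
  · simp [v, period_snd, pairing_apply, Prod.snd_sum, Finset.sum_apply]

theorem period_injective (hM : MatrixIsTypeJ M) (hα : IsRealSpectrum M α) :
    Function.Injective F.period := by
  rw [← LinearMap.ker_eq_bot, LinearMap.ker_eq_bot']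
  intro r h
  refine eq_zero_of_pairing hM hα F.a_ne_zero F.a_eigen F.isHalfSpectrum
    (congrFun (congrArg Prod.fst h)) ?_
  have h3 : (pairing r).comp (halfSpace M F.S).subtype = 0 :=
    F.b.ext (congrFun (congrArg Prod.snd h))
  exact fun w hw => LinearMap.congr_fun h3 ⟨w, hw⟩

/-- The vectors `v₁, …, v_N` form a basis of `ℝ^s × ℂ^n`. -/
noncomputable def periodEquiv (hM : MatrixIsTypeJ M) (hα : IsRealSpectrum M α) :
    (Fin (s + 2 * n) → ℝ) ≃L[ℝ] (Fin s → ℝ) × (Fin n → ℂ) :=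
  (LinearEquiv.ofInjectiveOfFinrankEq F.period (F.period_injective hM hα) (by
    rw [Module.finrank_prod, finrank_real_of_complex]; simp)).toContinuousLinearEquiv

@[simp]
theorem periodEquiv_apply (hM : MatrixIsTypeJ M) (hα : IsRealSpectrum M α)
    (r : Fin (s + 2 * n) → ℝ) : F.periodEquiv hM hα r = F.period r := rfl

/-- This is `⟨Mᵀ r, a_j⟩ = ⟨r, M a_j⟩` together with the eigenvector equation. -/
theorem period_transpose_fst (r : Fin (s + 2 * n) → ℝ) (j : Fin s) :
    (F.period (realMap (M : Matrix _ _ ℤ).transpose r)).1 j = α j * (F.period r).1 j := by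
  have h : ∀ k, ∑ l, ((M : Matrix (Fin (s + 2 * n)) (Fin (s + 2 * n)) ℤ) k l : ℝ) * F.a j l =
      α j * F.a j k := fun k => by
    have := congrFun (F.a_eigen j) k
    simpa [Matrix.mulVec, dotProduct] using this
  simp only [period_fst, realMap_apply, Matrix.transpose_apply, Finset.sum_mul, Finset.mul_sum]
  rw [Finset.sum_comm]
  refine Finset.sum_congr rfl fun k _ => ?_
  rw [mul_left_comm, ← h k, Finset.mul_sum]
  exact Finset.sum_congr rfl fun l _ => by ring

theorem pairing_transpose (r : Fin (s + 2 * n) → ℝ) (w : Fin (s + 2 * n) → ℂ) :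
    pairing (realMap (M : Matrix _ _ ℤ).transpose r) w = pairing r (complexMap M w) := by
  simp only [pairing_apply, realMap_apply, Matrix.transpose_apply, complexMap, Matrix.toLin'_apply,
    Matrix.mulVec, dotProduct, Matrix.map_apply, Finset.mul_sum, Complex.ofReal_sum,
    Finset.sum_mul]
  rw [Finset.sum_comm]
  refine Finset.sum_congr rfl fun k _ => Finset.sum_congr rfl fun l _ => ?_
  push_cast
  ring

/-- Moving `Mᵀ` across the pairing gives `⟨r, M b_l⟩`, and the coefficients of `M b_l` form the
`l`-th column of `R`; hence the transpose. -/
theorem period_transpose_snd (r : Fin (s + 2 * n) → ℝ) :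
    (F.period (realMap (M : Matrix _ _ ℤ).transpose r)).2 =
      F.R.transpose.mulVec (F.period r).2 := by
  ext l
  rw [period_snd, pairing_transpose]
  have h : ∀ u : halfSpace M F.S, pairing r u = ∑ i, F.b.repr u i * pairing r (F.b i) := by
    intro u
    conv_lhs => rw [← F.b.sum_repr u]
    rw [Submodule.coe_sum, map_sum]
    simp only [Submodule.coe_smul, map_smul, smul_eq_mul]
  refine (h ((complexMap M).restrict (mapsTo_halfSpace M F.S) (F.b l))).trans ?_
  simp only [Matrix.mulVec, dotProduct, period_snd, R, LinearMap.toMatrix_apply,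
    Matrix.transpose_apply]

theorem period_aeval_fst (P : ℤ[X]) (r : Fin (s + 2 * n) → ℝ) (j : Fin s) :
    (F.period (realMap (Polynomial.aeval (M : Matrix _ _ ℤ).transpose P) r)).1 j =
      Polynomial.aeval (α j) P * (F.period r).1 j :=
  map_realMap_aeval (((LinearMap.proj j).comp
    ((LinearMap.fst ℝ _ (Fin n → ℂ)).comp F.period)).toAddMonoidHom) _ (α j)
    (fun r => F.period_transpose_fst r j) P r

theorem period_aeval_snd (P : ℤ[X]) (r : Fin (s + 2 * n) → ℝ) :
    (F.period (realMap (Polynomial.aeval (M : Matrix _ _ ℤ).transpose P) r)).2 =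
      (Polynomial.aeval F.R.transpose P).mulVec (F.period r).2 := by
  -- `Rᵀ` is treated as an endomorphism so that it acts on vectors by `•`; `h2` then returns the
  -- polynomial to matrices.
  have h := map_realMap_aeval (A₀ := Module.End ℂ (Fin n → ℂ))
    (((LinearMap.snd ℝ (Fin s → ℝ) (Fin n → ℂ)).comp F.period).toAddMonoidHom)
    (M : Matrix (Fin (s + 2 * n)) (Fin (s + 2 * n)) ℤ).transpose
    (Matrix.toLinAlgEquiv' F.R.transpose) 
    (fun r => (F.period_transpose_snd r).trans (Matrix.toLinAlgEquiv'_apply _ _).symm) P r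
  have h2 : Polynomial.aeval (Matrix.toLinAlgEquiv' F.R.transpose) P =
      Matrix.toLinAlgEquiv' (Polynomial.aeval F.R.transpose P) :=
    Polynomial.aeval_algHom_apply
      (((Matrix.toLinAlgEquiv' : Matrix (Fin n) (Fin n) ℂ ≃ₐ[ℂ] _) :
        Matrix (Fin n) (Fin n) ℂ →ₐ[ℂ] Module.End ℂ (Fin n → ℂ)).restrictScalars ℤ) _ P
  rw [h2] at h
  exact h

variable {D : Fin s → ℤ[X]} (hD : IsDirichletFamily M α D)

/-- The action of `ℤ^s` on `ℝ^N` becomes diagonal in the coordinates of `ℝ^s`. -/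
theorem period_monodromyRep_fst (t : Fin s → Multiplicative ℤ) (r : Fin (s + 2 * n) → ℝ)
    (j : Fin s) :
    (F.period (realMap (monodromyRep hD t : Matrix _ _ ℤ) r)).1 j =
      Real.exp (∑ i, ((t i).toAdd : ℝ) * Real.log (Polynomial.aeval (α j) (D i))) *
        (F.period r).1 j := by
  -- Both sides are multiplicative in `t`, so the valid `t` form a subgroup and only the generators
  -- need checking.
  let H : Subgroup (Fin s → Multiplicative ℤ) :=
    { carrier := {t | ∀ r, (F.period (realMap (monodromyRep hD t : Matrix _ _ ℤ) r)).1 j =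
        Real.exp (∑ i, ((t i).toAdd : ℝ) * Real.log (Polynomial.aeval (α j) (D i))) *
        (F.period r).1 j}
      one_mem' := fun r => by simp
      mul_mem' := fun {t u} ht hu r => by
        rw [map_mul, Matrix.SpecialLinearGroup.coe_mul, map_mul, Module.End.mul_apply, ht, hu,
          ← mul_assoc, ← Real.exp_add, ← Finset.sum_add_distrib]
        simp [add_mul]
      inv_mem' := fun {t} ht r => by
        have h1 := ht (realMap (monodromyRep hD t⁻¹ : Matrix _ _ ℤ) r)
        rw [← Module.End.mul_apply, ← map_mul, ← Matrix.SpecialLinearGroup.coe_mul, ← map_mul,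
          mul_inv_cancel] at h1
        simp only [map_one, Matrix.SpecialLinearGroup.coe_one, Module.End.one_apply] at h1
        rw [h1, ← mul_assoc, ← Real.exp_add, ← Finset.sum_add_distrib]
        simp }
  refine (?_ : t ∈ H) r
  refine Subgroup.pi_mem_of_mulSingle_mem t fun i => ?_
  have hgen : Pi.mulSingle i (Multiplicative.ofAdd 1) ∈ H := by
    intro r
    rw [monodromyRep_mulSingle]
    refine (F.period_aeval_fst (D i) r j).trans ?_
    rw [Finset.sum_eq_single i (by
      intro b _ hb; simp [Pi.mulSingle_eq_of_ne hb]) (by simp)]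
    simp [Real.exp_log (hD.pos i j)]
  have := H.zpow_mem hgen (t i).toAdd
  rw [← Pi.mulSingle_zpow] at this
  convert this using 2
  rw [← ofAdd_zsmul]
  simp

/-- The action of `ℤ^s` on `ℝ^N` becomes complex linear in the coordinates of `ℂ^n`. -/
theorem exists_period_monodromyRep_snd (hM : MatrixIsTypeJ M) (hα : IsRealSpectrum M α)
    (t : Fin s → Multiplicative ℤ) :
    ∃ L : (Fin n → ℂ) →ₗ[ℂ] (Fin n → ℂ), ∀ r,
      (F.period (realMap (monodromyRep hD t : Matrix _ _ ℤ) r)).2 = L (F.period r).2 := by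
  have hsurj : ∀ z : Fin n → ℂ, ∃ r, (F.period r).2 = z := fun z =>
    ⟨(F.periodEquiv hM hα).symm (0, z), by
      rw [← F.periodEquiv_apply hM hα, ContinuousLinearEquiv.apply_symm_apply]⟩
  let H : Subgroup (Fin s → Multiplicative ℤ) :=
    { carrier := {t | ∃ L : (Fin n → ℂ) →ₗ[ℂ] (Fin n → ℂ), ∀ r,
        (F.period (realMap (monodromyRep hD t : Matrix _ _ ℤ) r)).2 = L (F.period r).2}
      one_mem' := ⟨LinearMap.id, fun r => by simp⟩
      mul_mem' := fun {t u} ⟨L, hL⟩ ⟨L', hL'⟩ => ⟨L.comp L', fun r => by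
        rw [map_mul, Matrix.SpecialLinearGroup.coe_mul, map_mul, Module.End.mul_apply, hL, hL']
        rfl⟩
      inv_mem' := fun {t} ⟨L, hL⟩ => by
        have hinv : ∀ r, L (F.period (realMap (monodromyRep hD t⁻¹ : Matrix _ _ ℤ) r)).2 =
            (F.period r).2 := fun r => by
          rw [← hL, ← Module.End.mul_apply, ← map_mul, ← Matrix.SpecialLinearGroup.coe_mul,
            ← map_mul, mul_inv_cancel]
          simp
        have hLs : Function.Surjective L := fun z => by
          obtain ⟨r, rfl⟩ := hsurj z
          exact ⟨_, hinv r⟩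
        -- The period map covers `ℂ^n`, so `L` is surjective, hence bijective in finite dimension;
        -- its inverse serves `t⁻¹`.
        let e := LinearEquiv.ofInjectiveEndo L (LinearMap.injective_iff_surjective.2 hLs)
        refine ⟨e.symm, fun r => ?_⟩
        refine (e.symm_apply_eq.2 ?_).symm
        exact (hinv r).symm }
  refine (?_ : t ∈ H)
  refine Subgroup.pi_mem_of_mulSingle_mem t fun i => ?_
  have hgen : Pi.mulSingle i (Multiplicative.ofAdd 1) ∈ H := by
    refine ⟨Matrix.toLin' (Polynomial.aeval F.R.transpose (D i)), fun r => ?_⟩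
    rw [monodromyRep_mulSingle]
    exact F.period_aeval_snd (D i) r
  have := H.zpow_mem hgen (t i).toAdd
  rw [← Pi.mulSingle_zpow] at this
  convert this using 2
  rw [← ofAdd_zsmul]
  simp

end Frame

end GenOT

/-! ### The affine model of the action -/

namespace GenOT

section Model

variable {N s : ℕ} {M : Matrix.SpecialLinearGroup (Fin N) ℤ} {α : Fin s → ℝ} {D : Fin s → ℤ[X]}
  {hD : IsDirichletFamily M α D}

/-- The component in `ℤ^s` of an element of `G_𝒟`. -/
noncomputable def GroupD.shift (g : GroupD hD) : Fin s → Multiplicative ℤ :=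
  SemidirectProduct.right g

/-- The component in `ℤ^N` of an element of `G_𝒟`. -/
noncomputable def GroupD.vec (g : GroupD hD) : Fin N → ℤ :=
  (SemidirectProduct.left g).toAdd

theorem GroupD.shift_mul (g h : GroupD hD) : (g * h).shift = g.shift * h.shift := rfl

theorem GroupD.vec_mul (g h : GroupD hD) :
    (g * h).vec = g.vec + (monodromyRep hD g.shift : Matrix _ _ ℤ).mulVec h.vec := rfl

theorem GroupD.shift_one : (1 : GroupD hD).shift = 1 := rfl

theorem GroupD.vec_one : (1 : GroupD hD).vec = 0 := rfl

theorem GroupD.ext_shift_vec {g h : GroupD hD} (h1 : g.shift = h.shift) (h2 : g.vec = h.vec) :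
    g = h :=
  SemidirectProduct.ext h2 h1

/-- The element of `G_𝒟` with given components. -/
noncomputable def GroupD.mk (hD : IsDirichletFamily M α D) (t : Fin s → ℤ) (m : Fin N → ℤ) : GroupD hD :=
  (⟨Multiplicative.ofAdd m, fun i => Multiplicative.ofAdd (t i)⟩ :
    Multiplicative (Fin N → ℤ) ⋊[(latticeAut N).comp (monodromyRep hD)] (Fin s → Multiplicative ℤ))

theorem GroupD.shift_mk (t : Fin s → ℤ) (m : Fin N → ℤ) :
    (GroupD.mk hD t m).shift = fun i => Multiplicative.ofAdd (t i) := rfl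

theorem GroupD.vec_mk (t : Fin s → ℤ) (m : Fin N → ℤ) : (GroupD.mk hD t m).vec = m := rfl

theorem shift_translation (m : Fin N → ℤ) : (translation hD m).shift = 1 := rfl

theorem vec_translation (m : Fin N → ℤ) : (translation hD m).vec = m := rfl

theorem shift_tau (i : Fin s) :
    (tau hD i).shift = Pi.mulSingle i (Multiplicative.ofAdd 1) := rfl

theorem vec_tau (i : Fin s) : (tau hD i).vec = 0 := rfl

/-- The affine action of `G_𝒟` on `ℝ^s × ℝ^N`. -/
noncomputable def affineMap (g : GroupD hD) (y : (Fin s → ℝ) × (Fin N → ℝ)) :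
    (Fin s → ℝ) × (Fin N → ℝ) :=
  (fun i => y.1 i + ((g.shift i).toAdd : ℝ),
    realMap (monodromyRep hD g.shift : Matrix _ _ ℤ) y.2 + fun k => (g.vec k : ℝ))

theorem affineMap_one (y : (Fin s → ℝ) × (Fin N → ℝ)) :
    affineMap (1 : GroupD hD) y = y := by
  ext k <;> simp [affineMap, GroupD.shift_one, GroupD.vec_one]

theorem affineMap_mul (g h : GroupD hD) (y : (Fin s → ℝ) × (Fin N → ℝ)) :
    affineMap (g * h) y = affineMap g (affineMap h y) := by
  ext k
  · simp [affineMap, GroupD.shift_mul]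
    ring
  · simp only [affineMap, GroupD.shift_mul, GroupD.vec_mul, map_mul, map_add,
      Matrix.SpecialLinearGroup.coe_mul, Module.End.mul_apply, realMap_intCast, Pi.add_apply,
      Int.cast_add]
    ring

theorem continuous_affineMap (g : GroupD hD) : Continuous (affineMap g) := by
  have h : Continuous (realMap (monodromyRep hD g.shift : Matrix (Fin N) (Fin N) ℤ)) :=
    LinearMap.continuous_of_finiteDimensional _
  unfold affineMap
  fun_prop

end Model

/-- The linear automorphism `c ↦ ∑ c_i log D_i` of `ℝ^s`. -/
noncomputable def logEquiv {N s : ℕ} {M : Matrix.SpecialLinearGroup (Fin N) ℤ} {α : Fin s → ℝ}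
    {D : Fin s → ℤ[X]} (hD : IsDirichletFamily M α D) : (Fin s → ℝ) ≃L[ℝ] (Fin s → ℝ) :=
  (Module.Basis.mk hD.isLogBasis.1 hD.isLogBasis.2.ge).equivFun.symm.toContinuousLinearEquiv

theorem logEquiv_apply {N s : ℕ} {M : Matrix.SpecialLinearGroup (Fin N) ℤ} {α : Fin s → ℝ}
    {D : Fin s → ℤ[X]} (hD : IsDirichletFamily M α D) (c : Fin s → ℝ) (j : Fin s) :
    logEquiv hD c j = ∑ i, c i * Real.log (Polynomial.aeval (α j) (D i)) := by
  simp [logEquiv, Module.Basis.equivFun_symm_apply]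

theorem mem_HC {s n : ℕ} {x : (Fin s → ℂ) × (Fin n → ℂ)} : x ∈ HC s n ↔ ∀ j, 0 < (x.1 j).im :=
  Iff.rfl

/-! ### Real coordinates on `ℍ^s × ℂ^n` and the twisted diagonal action -/

namespace Frame

variable {s n : ℕ} {M : Matrix.SpecialLinearGroup (Fin (s + 2 * n)) ℤ} {α : Fin s → ℝ}
  (F : Frame M α) {D : Fin s → ℤ[X]} (hM : MatrixIsTypeJ M) (hα : IsRealSpectrum M α)
  (hD : IsDirichletFamily M α D)

/-- The real coordinates on `ℍ^s × ℂ^n` in which the action of `G_𝒟` is affine. -/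
noncomputable def coord : HC s n ≃ₜ (Fin s → ℝ) × (Fin (s + 2 * n) → ℝ) where
  -- A generator scales both parts of `w_j` by `D_i(α_j)`: on `Im w` this is a translation of the
  -- log coordinates, on `(Re w, z)` the matrix `D_i(Mᵀ)`.
  toFun x := ((logEquiv hD).symm fun j => Real.log (x.1.1 j).im,
    (F.periodEquiv hM hα).symm (fun j => (x.1.1 j).re, x.1.2))
  invFun y := ⟨(fun j => ((F.periodEquiv hM hα y.2).1 j : ℂ) +
      (Real.exp (logEquiv hD y.1 j) : ℂ) * Complex.I, (F.periodEquiv hM hα y.2).2), by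
    rw [mem_HC]
    intro j
    rw [Complex.add_im, Complex.ofReal_im, Complex.im_ofReal_mul, Complex.I_im, mul_one, zero_add]
    exact Real.exp_pos _⟩
  left_inv x := by
    apply Subtype.ext
    ext j
    · simp only [ContinuousLinearEquiv.apply_symm_apply]
      rw [Real.exp_log (x.2 j), Complex.re_add_im]
    · simp only [ContinuousLinearEquiv.apply_symm_apply]
  right_inv y := by
    have him : ∀ a b : ℝ, ((a : ℂ) + (b : ℂ) * Complex.I).im = b := fun a b => by simp
    have hre : ∀ a b : ℝ, ((a : ℂ) + (b : ℂ) * Complex.I).re = a := fun a b => by simp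
    simp only [him, hre, Real.log_exp]
    exact Prod.ext ((logEquiv hD).symm_apply_apply y.1)
      ((F.periodEquiv hM hα).symm_apply_apply y.2)
  continuous_toFun := by
    have h1 : Continuous fun (x : HC s n) (j : Fin s) => Real.log (x.1.1 j).im :=
      continuous_pi fun j => Continuous.log (by fun_prop) fun x => (x.2 j).ne'
    have h2 : Continuous fun (x : HC s n) => ((fun j => (x.1.1 j).re, x.1.2) :
        (Fin s → ℝ) × (Fin n → ℂ)) := by fun_prop
    exact ((logEquiv hD).symm.continuous.comp h1).prodMk
      ((F.periodEquiv hM hα).symm.continuous.comp h2)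
  continuous_invFun := by
    refine Continuous.subtype_mk ?_ _
    have h1 := (F.periodEquiv hM hα).continuous
    have h2 := (logEquiv hD).continuous
    fun_prop

theorem coord_symm_fst (y : (Fin s → ℝ) × (Fin (s + 2 * n) → ℝ)) (j : Fin s) :
    ((F.coord hM hα hD).symm y).1.1 j =
      ((F.period y.2).1 j : ℂ) + (Real.exp (logEquiv hD y.1 j) : ℂ) * Complex.I := rfl

theorem coord_symm_snd (y : (Fin s → ℝ) × (Fin (s + 2 * n) → ℝ)) :
    ((F.coord hM hα hD).symm y).1.2 = (F.period y.2).2 := rfl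

theorem coord_fst_eq {x : HC s n} {c : Fin s → ℝ}
    (hc : ∀ j, Real.log (x.1.1 j).im = ∑ i, c i * Real.log (Polynomial.aeval (α j) (D i))) :
    (F.coord hM hα hD x).1 = c := by
  change (logEquiv hD).symm _ = c
  rw [ContinuousLinearEquiv.symm_apply_eq]
  ext j
  rw [logEquiv_apply, hc]

/-- The twisted diagonal action of `G_𝒟` on `ℍ^s × ℂ^n`. -/
@[reducible]
noncomputable def action : MulAction (GroupD hD) (HC s n) where
  smul g x := (F.coord hM hα hD).symm (affineMap g (F.coord hM hα hD x))
  one_smul x := by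
    change (F.coord hM hα hD).symm (affineMap 1 _) = x
    rw [affineMap_one, Homeomorph.symm_apply_apply]
  mul_smul g h x := by
    change (F.coord hM hα hD).symm (affineMap (g * h) _) =
      (F.coord hM hα hD).symm (affineMap g (F.coord hM hα hD ((F.coord hM hα hD).symm _)))
    rw [affineMap_mul, Homeomorph.apply_symm_apply]

theorem coord_smul (g : GroupD hD) (x : HC s n) :
    let := F.action hM hα hD
    F.coord hM hα hD (g • x) = affineMap g (F.coord hM hα hD x) :=
  (F.coord hM hα hD).apply_symm_apply _

/-- Every element of `G_𝒟` acts on `ℍ^s × ℂ^n` by a complex affine map which is diagonal on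
the first factor. -/
theorem exists_smul_eq (g : GroupD hD) :
    ∃ L : (Fin n → ℂ) →ₗ[ℂ] (Fin n → ℂ),
      (∀ r, (F.period (realMap (monodromyRep hD g.shift : Matrix _ _ ℤ) r)).2 =
        L (F.period r).2) ∧
      ∀ x : HC s n,
      let := F.action hM hα hD
      ((g • x : HC s n) : (Fin s → ℂ) × (Fin n → ℂ)) =
        (fun j => ((Real.exp (∑ i, ((g.shift i).toAdd : ℝ) *
          Real.log (Polynomial.aeval (α j) (D i))) : ℝ) : ℂ) * x.1.1 j, L x.1.2) +
          ∑ k, g.vec k • F.v k := by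
  obtain ⟨L, hL⟩ := F.exists_period_monodromyRep_snd hD hM hα g.shift
  refine ⟨L, hL, fun x => ?_⟩
  obtain ⟨y, rfl⟩ := (F.coord hM hα hD).symm.surjective x
  have h : letI := F.action hM hα hD
      g • (F.coord hM hα hD).symm y = (F.coord hM hα hD).symm (affineMap g y) := by
    change (F.coord hM hα hD).symm (affineMap g (F.coord hM hα hD _)) = _
    rw [Homeomorph.apply_symm_apply]
  refine (congrArg Subtype.val h).trans ?_
  rw [sum_smul_v]
  refine Prod.ext (funext fun j => ?_) ?_
  · simp only [Prod.fst_add, Pi.add_apply]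
    rw [coord_symm_fst, coord_symm_fst]
    simp only [affineMap, map_add, Prod.fst_add, Pi.add_apply, period_monodromyRep_fst]
    -- The translation by `t` scales `Im w_j` by the same factor by which `ρ(t)` scales `Re w_j`, so
    -- together they multiply `w_j` by a real number.
    have hexp : Real.exp (logEquiv hD (fun i => y.1 i + ((g.shift i).toAdd : ℝ)) j) =
        Real.exp (∑ i, ((g.shift i).toAdd : ℝ) * Real.log (Polynomial.aeval (α j) (D i))) *
          Real.exp (logEquiv hD y.1 j) := by
      rw [← Real.exp_add, logEquiv_apply, logEquiv_apply, ← Finset.sum_add_distrib]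
      congr 1
      exact Finset.sum_congr rfl fun i _ => by ring
    rw [hexp]
    push_cast
    ring
  · simp only [Prod.snd_add]
    rw [coord_symm_snd, coord_symm_snd]
    simp only [affineMap, map_add, Prod.snd_add, hL]

theorem isTwistedDiagonal_action :
    let := F.action hM hα hD
    IsTwistedDiagonal F hD := by
  let := F.action hM hα hD
  refine ⟨fun m x => ?_, fun i x => ?_⟩
  · obtain ⟨L, hL, h⟩ := F.exists_smul_eq hM hα hD (translation hD m)
    rw [h x, vec_translation]
    -- `L` is known only on periods, so it is evaluated at the real vector with period `(0, z)`.
    have hL1 : L x.1.2 = x.1.2 := by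
      have := hL ((F.periodEquiv hM hα).symm (0, x.1.2))
      rw [shift_translation, map_one, Matrix.SpecialLinearGroup.coe_one, map_one,
        Module.End.one_apply, ← F.periodEquiv_apply hM hα,
        ContinuousLinearEquiv.apply_symm_apply] at this
      exact this.symm
    rw [hL1, shift_translation]
    simp
  · obtain ⟨L, hL, h⟩ := F.exists_smul_eq hM hα hD (tau hD i)
    rw [h x, vec_tau]
    have hL1 : L x.1.2 = (Polynomial.aeval F.R.transpose (D i)).mulVec x.1.2 := by
      have h1 := hL ((F.periodEquiv hM hα).symm (0, x.1.2))
      have h2 := F.period_aeval_snd (D i) ((F.periodEquiv hM hα).symm (0, x.1.2))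
      rw [shift_tau, monodromyRep_mulSingle] at h1
      have h3 := h1.symm.trans h2
      rwa [← F.periodEquiv_apply hM hα, ContinuousLinearEquiv.apply_symm_apply] at h3
    rw [hL1, shift_tau]
    simp only [Pi.zero_apply, zero_smul, Finset.sum_const_zero, add_zero]
    refine Prod.ext (funext fun j => ?_) rfl
    simp only
    rw [Finset.sum_eq_single i (by
      intro b _ hb; simp [Pi.mulSingle_eq_of_ne hb]) (by simp)]
    simp [Real.exp_log (hD.pos i j)]

theorem contMDiff_smul (g : GroupD hD) :
    let := F.action hM hα hD
    ContMDiff 𝓘(ℂ, (Fin s → ℂ) × (Fin n → ℂ)) 𝓘(ℂ, (Fin s → ℂ) × (Fin n → ℂ)) ω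
      (fun x : HC s n => (g • x : HC s n)) := by
  let := F.action hM hα hD
  obtain ⟨L, -, h⟩ := F.exists_smul_eq hM hα hD g
  let f : (Fin s → ℂ) × (Fin n → ℂ) → (Fin s → ℂ) × (Fin n → ℂ) := fun x =>
    (fun j => ((Real.exp (∑ i, ((g.shift i).toAdd : ℝ) *
      Real.log (Polynomial.aeval (α j) (D i))) : ℝ) : ℂ) * x.1 j, L.toContinuousLinearMap x.2) +
      ∑ k, g.vec k • F.v k
  have hf : ContDiff ℂ ω f := by
    refine ContDiff.add (ContDiff.prodMk ?_ ?_) contDiff_const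
    · exact contDiff_pi.2 fun j => contDiff_const.mul
        ((contDiff_apply ℂ ℂ j).comp contDiff_fst)
    · exact L.toContinuousLinearMap.contDiff.comp contDiff_snd
  have h2 : ContMDiff 𝓘(ℂ, (Fin s → ℂ) × (Fin n → ℂ)) 𝓘(ℂ, (Fin s → ℂ) × (Fin n → ℂ)) ω
      (fun x : HC s n => f x.1) := hf.contMDiff.comp contMDiff_subtype_val
  have h3 : (Subtype.val ∘ fun x : HC s n => (g • x : HC s n)) = fun x : HC s n => f x.1 :=
    funext fun x => h x
  rw [← h3] at h2
  -- Smoothness into the open subset can be tested after inclusion in the ambient space.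
  exact fun x => (ChartedSpace.liftPropWithinAt_subtypeVal_comp_iff _ _ _).1 (h2 x)

end Frame

/-- On the vector with period `((1, …, 1), 0)`, `ρ(t) = 1` forces every `exp (∑ t_i log D_i(α_j))`
to be `1`; the log-basis property then gives `t = 0`. -/
theorem monodromyRep_injective {s n : ℕ} {M : Matrix.SpecialLinearGroup (Fin (s + 2 * n)) ℤ}
    {α : Fin s → ℝ} (F : Frame M α) {D : Fin s → ℤ[X]} (hM : MatrixIsTypeJ M)
    (hα : IsRealSpectrum M α) (hD : IsDirichletFamily M α D) :
    Function.Injective (monodromyRep hD) := by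
  rw [injective_iff_map_eq_one]
  intro t ht
  have h : logEquiv hD (fun i => ((t i).toAdd : ℝ)) = 0 := by
    ext j
    have h1 := F.period_monodromyRep_fst hD t ((F.periodEquiv hM hα).symm (fun _ => 1, 0)) j
    rw [ht, Matrix.SpecialLinearGroup.coe_one, map_one, Module.End.one_apply,
      ← F.periodEquiv_apply hM hα, ContinuousLinearEquiv.apply_symm_apply, mul_one] at h1
    rw [logEquiv_apply]
    exact (Real.exp_eq_one_iff _).1 h1.symm
  rw [map_eq_zero_iff _ (logEquiv hD).injective] at h
  ext i
  have := congrFun h i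
  simpa using this

end GenOT

/-! ### Tori and local trivializations -/

namespace GenOT

section Torus

variable {s : ℕ}

theorem isOpenQuotientMap_toTorus :
    IsOpenQuotientMap (toTorus : (Fin s → ℝ) → UnitAddTorus (Fin s)) :=
  IsOpenQuotientMap.piMap fun _ => QuotientAddGroup.isOpenQuotientMap_mk

theorem toTorus_eq_iff {c c' : Fin s → ℝ} :
    toTorus c = toTorus c' ↔ ∃ t : Fin s → ℤ, ∀ i, c' i = c i + t i := by
  have h : ∀ i, (c i : UnitAddCircle) = (c' i : UnitAddCircle) ↔ ∃ t : ℤ, c' i = c i + t := by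
    intro i
    rw [QuotientAddGroup.eq, AddSubgroup.mem_zmultiples_iff]
    refine exists_congr fun t => ?_
    rw [zsmul_one]
    constructor <;> intro h <;> linarith
  rw [← Classical.skolem (p := fun i (t : ℤ) => c' i = c i + t), funext_iff]
  exact forall_congr' h

theorem torusMap_toTorus {N : ℕ} (A : Matrix.SpecialLinearGroup (Fin N) ℤ) (r : Fin N → ℝ) :
    torusMap A (toTorus r) = toTorus (realMap (A : Matrix _ _ ℤ) r) := by
  ext k
  simp only [torusMap, toTorus, realMap_apply]
  rw [← QuotientAddGroup.mk'_apply, map_sum]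
  refine Finset.sum_congr rfl fun l _ => ?_
  rw [← zsmul_eq_mul, map_zsmul]
  rfl

/-- The covering `ℝ^s → 𝕋^s` has sections which are continuous near a given point. -/
theorem exists_section_toTorus (c : UnitAddTorus (Fin s)) :
    ∃ (U : Set (UnitAddTorus (Fin s))) (σ : UnitAddTorus (Fin s) → Fin s → ℝ),
      IsOpen U ∧ c ∈ U ∧ ContinuousOn σ U ∧ ∀ b, toTorus (σ b) = b := by
  have h1 : ∀ x : UnitAddCircle, ∃ e : OpenPartialHomeomorph ℝ UnitAddCircle,
      x ∈ e.target ∧ ∀ y, ((e.symm y : ℝ) : UnitAddCircle) = y := by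
    intro x
    obtain ⟨y, rfl⟩ := QuotientAddGroup.mk_surjective x
    -- Starting the period interval at `y - 1/2` puts `y` in its interior. The inverse is a section
    -- on the whole circle, continuous away from the cut.
    refine ⟨AddCircle.openPartialHomeomorphCoe (1 : ℝ) (y - 1 / 2), ?_,
      fun z => (AddCircle.equivIco (1 : ℝ) (y - 1 / 2)).symm_apply_apply z⟩
    refine (AddCircle.openPartialHomeomorphCoe (1 : ℝ) (y - 1 / 2)).map_source (x := y) ?_
    constructor <;> linarith
  choose e he hy using fun i => h1 (c i)
  refine ⟨Set.univ.pi fun i => (e i).target, fun b i => (e i).symm (b i),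
    isOpen_set_pi Set.finite_univ fun i _ => (e i).open_target, fun i _ => he i, ?_, ?_⟩
  · refine continuousOn_pi.2 fun i => ?_
    exact (e i).continuousOn_symm.comp (continuous_apply i).continuousOn fun b hb => hb i trivial
  · intro b
    ext i
    exact hy i _

/-- A global trivialization over the universal covering of the torus yields local
trivializations. -/
theorem isFibration_of_pullback {T F : Type*} [TopologicalSpace T] [TopologicalSpace F]
    {p : T → UnitAddTorus (Fin s)} (hp : Continuous p)
    (Θ : ((Fin s → ℝ) × F) ≃ₜ {q : (Fin s → ℝ) × T // p q.2 = toTorus q.1})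
    (hΘ : ∀ c x, (Θ (c, x)).1.1 = c) : IsFibration F p := by
  intro c
  obtain ⟨U, σ, hU, hc, hσ, hσb⟩ := exists_section_toTorus c
  have hΘs : ∀ q, (Θ.symm q).1 = q.1.1 := fun q => by
    rw [← hΘ (Θ.symm q).1 (Θ.symm q).2, Prod.mk.eta, Homeomorph.apply_symm_apply]
  have hpΘ : ∀ b x, p (Θ (σ b, x)).1.2 = b := fun b x => by
    rw [(Θ (σ b, x)).2, hΘ, hσb b]
  -- The fibre coordinate of `t` is read from `Θ⁻¹` at the lift `σ (p t)`. As `σ` is a section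
  -- everywhere, the formulas make sense outside `U` too.
  refine ⟨{ toFun := fun t => (p t, (Θ.symm ⟨(σ (p t), t), (hσb _).symm⟩).2)
            invFun := fun y => (Θ (σ y.1, y.2)).1.2
            source := p ⁻¹' U
            target := U ×ˢ Set.univ
            map_source' := fun t ht => ⟨ht, trivial⟩
            map_target' := fun y hy => by
              rw [Set.mem_preimage, hpΘ]
              exact hy.1
            left_inv' := fun t _ => ?_
            right_inv' := fun y _ => ?_
            open_source := hU.preimage hp
            open_target := hU.prod isOpen_univ
            continuousOn_toFun := ?_
            continuousOn_invFun := ?_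
            baseSet := U
            open_baseSet := hU
            source_eq := rfl
            target_eq := rfl
            proj_toFun := fun _ _ => rfl }, hc⟩
  · have h : (σ (p t), (Θ.symm ⟨(σ (p t), t), (hσb _).symm⟩).2) =
        Θ.symm ⟨(σ (p t), t), (hσb _).symm⟩ := 
      Prod.ext (hΘs ⟨(σ (p t), t), (hσb _).symm⟩).symm rfl
    simp only [h, Homeomorph.apply_symm_apply]
  · refine Prod.ext (hpΘ _ _) ?_
    have h : (⟨(σ (p (Θ (σ y.1, y.2)).1.2), (Θ (σ y.1, y.2)).1.2), (hσb _).symm⟩ :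
        {q : (Fin s → ℝ) × T // p q.2 = toTorus q.1}) = Θ (σ y.1, y.2) := by
      refine Subtype.ext (Prod.ext ?_ rfl)
      rw [hΘ]
      exact congrArg σ (hpΘ _ _)
    simp only [h, Homeomorph.symm_apply_apply]
  · have h1 : ContinuousOn (fun t => σ (p t)) (p ⁻¹' U) :=
      hσ.comp hp.continuousOn fun _ h => h
    refine hp.continuousOn.prodMk (continuous_snd.comp_continuousOn
      (Θ.symm.continuous.comp_continuousOn ?_))
    rw [continuousOn_iff_continuous_domRestrict] at h1 ⊢
    exact Continuous.subtype_mk (h1.prodMk continuous_subtype_val) _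
  · have h1 : ContinuousOn (fun y : UnitAddTorus (Fin s) × F => σ y.1) (U ×ˢ Set.univ) :=
      hσ.comp continuous_fst.continuousOn fun _ h => h.1
    exact (continuous_snd.comp continuous_subtype_val).comp_continuousOn
      (Θ.continuous.comp_continuousOn (h1.prodMk continuous_snd.continuousOn))

end Torus

/-- Two open quotient maps with the same fibres have homeomorphic targets. -/
theorem exists_homeomorph_of_isOpenQuotientMap {X Y Z : Type*} [TopologicalSpace X]
    [TopologicalSpace Y] [TopologicalSpace Z] {f : X → Y} {g : X → Z} (hf : IsOpenQuotientMap f)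
    (hg : IsOpenQuotientMap g) (h : ∀ x x', f x = f x' ↔ g x = g x') :
    ∃ Θ : Y ≃ₜ Z, ∀ x, Θ (f x) = g x := by
  have h1 : ∀ x, g (Function.surjInv hf.surjective (f x)) = g x := fun x =>
    (h _ _).1 (Function.surjInv_eq hf.surjective (f x))
  have h2 : ∀ x, f (Function.surjInv hg.surjective (g x)) = f x := fun x =>
    (h _ _).2 (Function.surjInv_eq hg.surjective (g x))
  refine ⟨{ toFun := fun y => g (Function.surjInv hf.surjective y)
            invFun := fun z => f (Function.surjInv hg.surjective z)
            left_inv := fun y => ?_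
            right_inv := fun z => ?_
            continuous_toFun := ?_
            continuous_invFun := ?_ }, h1⟩
  · simp only [h2, Function.surjInv_eq]
  · simp only [h1, Function.surjInv_eq]
  · rw [← hf.continuous_comp_iff]
    exact hg.continuous.congr fun x => (h1 x).symm
  · rw [← hg.continuous_comp_iff]
    exact hf.continuous.congr fun x => (h2 x).symm

theorem finite_setOf_abs_le {ι : Type*} [Finite ι] (C : ℝ) :
    {m : ι → ℤ | ∀ i, |(m i : ℝ)| ≤ C}.Finite := by
  classical
  have := Fintype.ofFinite ι
  refine (Set.finite_Icc (fun _ : ι => -⌈C⌉) (fun _ => ⌈C⌉)).subset fun m hm => ?_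
  refine ⟨fun i => ?_, fun i => ?_⟩
  · have h1 := (abs_le.1 (hm i)).1
    have h2 := Int.le_ceil C
    have h3 : (-(⌈C⌉ : ℤ) : ℝ) ≤ m i := by linarith
    exact_mod_cast h3
  · have h1 := (abs_le.1 (hm i)).2.trans (Int.le_ceil C)
    exact_mod_cast h1

/-! ### Topology of the quotient from the affine model -/

section AffineModel

variable {N s : ℕ} {M : Matrix.SpecialLinearGroup (Fin N) ℤ} {α : Fin s → ℝ} {D : Fin s → ℤ[X]}
  {hD : IsDirichletFamily M α D} {X : Type*} [TopologicalSpace X] [MulAction (GroupD hD) X]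
  {Φ : X ≃ₜ (Fin s → ℝ) × (Fin N → ℝ)}

theorem continuousConstSMul_of_affine
    (hΦ : ∀ (g : GroupD hD) x, Φ (g • x) = affineMap g (Φ x)) :
    ContinuousConstSMul (GroupD hD) X where
  continuous_const_smul g := by
    have h : (fun x : X => g • x) = fun x => Φ.symm (affineMap g (Φ x)) :=
      funext fun x => by rw [← hΦ, Homeomorph.symm_apply_apply]
    rw [h]
    exact Φ.symm.continuous.comp ((continuous_affineMap g).comp Φ.continuous)

theorem eq_one_of_affine (hΦ : ∀ (g : GroupD hD) x, Φ (g • x) = affineMap g (Φ x))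
    {g : GroupD hD} {x : X} (h : g • x = x) : g = 1 := by
  have h1 := hΦ g x
  rw [h] at h1
  have ht : g.shift = 1 := by
    ext i
    have := congrFun (congrArg Prod.fst h1) i
    simpa [affineMap] using this
  refine GroupD.ext_shift_vec ht ?_
  ext k
  have := congrFun (congrArg Prod.snd h1) k
  simpa [affineMap, ht, GroupD.vec_one] using this

theorem exists_abs_le_of_isCompact {ι : Type*} [Fintype ι] {K : Set X} (hK : IsCompact K)
    {f : X → ι → ℝ} (hf : Continuous f) : ∃ C : ℝ, ∀ x ∈ K, ∀ i, |f x i| ≤ C := by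
  obtain ⟨C, hC⟩ := hK.exists_bound_of_continuousOn hf.continuousOn
  exact ⟨C, fun x hx i => (norm_le_pi_norm (f x) i).trans (hC x hx)⟩

theorem shift_eq_sub_of_affine (hΦ : ∀ (g : GroupD hD) x, Φ (g • x) = affineMap g (Φ x))
    (g : GroupD hD) (x : X) (i : Fin s) :
    ((g.shift i).toAdd : ℝ) = (Φ (g • x)).1 i - (Φ x).1 i := by
  rw [hΦ]; simp [affineMap]

theorem vec_eq_sub_of_affine (hΦ : ∀ (g : GroupD hD) x, Φ (g • x) = affineMap g (Φ x))
    (g : GroupD hD) (x : X) (k : Fin N) :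
    (g.vec k : ℝ) = (Φ (g • x)).2 k -
      realMap (monodromyRep hD g.shift : Matrix _ _ ℤ) (Φ x).2 k := by
  rw [hΦ]; simp [affineMap]

/-- On a compact set the shift is a difference of bounded coordinates, so it takes finitely many
values. For each of these the linear part is fixed and the translation part is bounded as well. -/
theorem finite_smul_inter_of_affine (hΦ : ∀ (g : GroupD hD) x, Φ (g • x) = affineMap g (Φ x))
    {K : Set X} (hK : IsCompact K) : {g : GroupD hD | ∃ x ∈ K, g • x ∈ K}.Finite := by
  obtain ⟨C₁, hC₁⟩ := exists_abs_le_of_isCompact hK (continuous_fst.comp Φ.continuous)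
  obtain ⟨C₂, hC₂⟩ := exists_abs_le_of_isCompact hK (continuous_snd.comp Φ.continuous)
  have hlin : ∀ t : Fin s → Multiplicative ℤ, ∃ C : ℝ, ∀ x ∈ K, ∀ k,
      |realMap (monodromyRep hD t : Matrix _ _ ℤ) (Φ x).2 k| ≤ C := fun t =>
    exists_abs_le_of_isCompact hK ((LinearMap.continuous_of_finiteDimensional
      (realMap (monodromyRep hD t : Matrix (Fin N) (Fin N) ℤ))).comp
        (continuous_snd.comp Φ.continuous))
  choose C₃ hC₃ using hlin
  refine (((finite_setOf_abs_le (ι := Fin s) (C₁ + C₁)).biUnion fun t _ =>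
    (finite_setOf_abs_le (ι := Fin N) (C₂ + C₃ fun i => Multiplicative.ofAdd (t i))).image
      (GroupD.mk hD t))).subset ?_
  rintro g ⟨x, hx, hy⟩
  refine Set.mem_iUnion₂.2 ⟨fun i => (g.shift i).toAdd, fun i => ?_, g.vec, fun k => ?_,
    GroupD.ext_shift_vec rfl rfl⟩
  · rw [shift_eq_sub_of_affine hΦ g x]
    exact (abs_sub _ _).trans (add_le_add (hC₁ _ hy i) (hC₁ _ hx i))
  · rw [vec_eq_sub_of_affine hΦ g x]
    exact (abs_sub _ _).trans (add_le_add (hC₂ _ hy k) (hC₃ _ _ hx k))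

theorem properlyDiscontinuousSMul_of_affine
    (hΦ : ∀ (g : GroupD hD) x, Φ (g • x) = affineMap g (Φ x)) :
    ProperlyDiscontinuousSMul (GroupD hD) X where
  finite_disjoint_inter_image {K L} hK hL := by
    refine (finite_smul_inter_of_affine hΦ (hK.union hL)).subset ?_
    rintro g ⟨_, ⟨x, hx, rfl⟩, hy⟩
    exact ⟨x, Or.inl hx, Or.inr hy⟩

theorem quotient_mk_eq_iff_of_affine (hΦ : ∀ (g : GroupD hD) x, Φ (g • x) = affineMap g (Φ x))
    {y z : (Fin s → ℝ) × (Fin N → ℝ)} :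
    Quotient.mk (MulAction.orbitRel (GroupD hD) X) (Φ.symm y) = Quotient.mk _ (Φ.symm z) ↔
      ∃ g : GroupD hD, affineMap g z = y := by
  rw [Quotient.eq, MulAction.orbitRel_apply, MulAction.mem_orbit_iff]
  refine exists_congr fun g => ?_
  rw [← Φ.injective.eq_iff, hΦ, Homeomorph.apply_symm_apply, Homeomorph.apply_symm_apply]

/-- The unit cube meets every orbit, so its compact image is the whole quotient. -/
theorem compactSpace_of_affine (hΦ : ∀ (g : GroupD hD) x, Φ (g • x) = affineMap g (Φ x)) :
    CompactSpace (Quotient (MulAction.orbitRel (GroupD hD) X)) := by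
  have hK : IsCompact (Set.Icc (0 : (Fin s → ℝ) × (Fin N → ℝ)) 1) := isCompact_Icc
  have h2 := hK.image (f := fun y => Quotient.mk (MulAction.orbitRel (GroupD hD) X) (Φ.symm y))
    (continuous_quot_mk.comp Φ.symm.continuous)
  refine ⟨h2.of_isClosed_subset isClosed_univ fun q _ => ?_⟩
  obtain ⟨x, rfl⟩ := Quotient.mk_surjective q
  obtain ⟨y, rfl⟩ := Φ.symm.surjective x
  let t : Fin s → ℤ := fun i => -⌊y.1 i⌋
  -- The shift also applies `ρ(t)` to the second coordinate, so the lattice correction is computed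
  -- after it.
  let r : Fin N → ℝ :=
    realMap (monodromyRep hD fun i => Multiplicative.ofAdd (t i) : Matrix _ _ ℤ) y.2
  let g : GroupD hD := GroupD.mk hD t fun k => -⌊r k⌋
  have h : affineMap g y = (fun i => Int.fract (y.1 i), fun k => Int.fract (r k)) := by
    ext k
    · simp [affineMap, g, t, GroupD.shift_mk, Int.fract, sub_eq_add_neg]
    · simp only [affineMap, g, GroupD.shift_mk, GroupD.vec_mk, Int.fract, sub_eq_add_neg,
        Pi.add_apply, Int.cast_neg]
      rfl
  refine ⟨affineMap g y, ?_, (quotient_mk_eq_iff_of_affine hΦ).2 ⟨g, rfl⟩⟩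
  rw [h]
  exact ⟨⟨fun i => Int.fract_nonneg _, fun i => Int.fract_nonneg _⟩,
    ⟨fun i => (Int.fract_lt_one _).le, fun i => (Int.fract_lt_one _).le⟩⟩

/-- The projection to the torus `𝕋^s` induced by the first coordinate. -/
noncomputable def torusProj (hΦ : ∀ (g : GroupD hD) x, Φ (g • x) = affineMap g (Φ x)) :
    Quotient (MulAction.orbitRel (GroupD hD) X) → UnitAddTorus (Fin s) :=
  Quotient.lift (fun x => toTorus (Φ x).1) (by
    rintro a b hab
    obtain ⟨g, rfl⟩ := MulAction.mem_orbit_iff.1 (MulAction.orbitRel_apply.1 hab)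
    refine (toTorus_eq_iff.2 ⟨fun i => (g.shift i).toAdd, fun i => ?_⟩).symm
    rw [hΦ]
    rfl)

theorem torusProj_mk (hΦ : ∀ (g : GroupD hD) x, Φ (g • x) = affineMap g (Φ x)) (x : X) :
    torusProj hΦ (Quotient.mk _ x) = toTorus (Φ x).1 := rfl

theorem continuous_torusProj (hΦ : ∀ (g : GroupD hD) x, Φ (g • x) = affineMap g (Φ x)) :
    Continuous (torusProj hΦ) :=
  Continuous.quotient_lift (isOpenQuotientMap_toTorus.continuous.comp
    (continuous_fst.comp Φ.continuous)) _

/-- The parametrization of the pull-back of the quotient to `ℝ^s` by `ℝ^s × ℝ^N`. -/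
noncomputable def pullbackParam (hΦ : ∀ (g : GroupD hD) x, Φ (g • x) = affineMap g (Φ x))
    (y : (Fin s → ℝ) × (Fin N → ℝ)) :
    {q : (Fin s → ℝ) × Quotient (MulAction.orbitRel (GroupD hD) X) //
      torusProj hΦ q.2 = toTorus q.1} :=
  ⟨(y.1, Quotient.mk _ (Φ.symm y)), by rw [torusProj_mk, Homeomorph.apply_symm_apply]⟩

theorem isOpenQuotientMap_pullbackParam
    (hΦ : ∀ (g : GroupD hD) x, Φ (g • x) = affineMap g (Φ x)) :
    IsOpenQuotientMap (pullbackParam hΦ) := by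
  have := continuousConstSMul_of_affine hΦ
  refine ⟨?_, ?_, ?_⟩
  · rintro ⟨⟨c, q⟩, hq⟩
    obtain ⟨x, rfl⟩ := Quotient.mk_surjective q
    obtain ⟨y, rfl⟩ := Φ.symm.surjective x
    simp only [torusProj_mk, Homeomorph.apply_symm_apply] at hq
    obtain ⟨t, ht⟩ := toTorus_eq_iff.1 hq
    -- Shifting by `t` corrects the first coordinate to `c` without leaving the orbit.
    refine ⟨affineMap (GroupD.mk hD t 0) y, Subtype.ext (Prod.ext ?_ ?_)⟩
    · exact (funext ht).symm
    · exact (quotient_mk_eq_iff_of_affine hΦ).2 ⟨_, rfl⟩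
  · exact Continuous.subtype_mk (continuous_fst.prodMk
      (continuous_quot_mk.comp Φ.symm.continuous)) _
  · rw [isOpenMap_iff_nhds_le]
    intro y V hV
    rw [Filter.mem_map] at hV
    -- Radius `1/2` keeps two first coordinates in the ball less than `1` apart; if they also differ
    -- by an integer vector, they are equal.
    have hball : Prod.fst ⁻¹' Metric.ball y.1 (1 / 2) ∈ nhds y :=
      continuous_fst.continuousAt.preimage_mem_nhds (Metric.ball_mem_nhds _ (by norm_num))
    have hopen : IsOpenMap fun z : (Fin s → ℝ) × (Fin N → ℝ) =>
        Quotient.mk (MulAction.orbitRel (GroupD hD) X) (Φ.symm z) :=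
      MulAction.isOpenQuotientMap_quotientMk.isOpenMap.comp Φ.symm.isOpenMap
    have h1 := hopen.image_mem_nhds (Filter.inter_mem hV hball)
    have hcont : Continuous fun q : {q : (Fin s → ℝ) × Quotient (MulAction.orbitRel (GroupD hD) X) //
      torusProj hΦ q.2 = toTorus q.1} => q.1 := continuous_subtype_val
    have h2 : ∀ᶠ q in nhds (pullbackParam hΦ y), q.1.1 ∈ Metric.ball y.1 (1 / 2) :=
      (continuous_fst.comp hcont).continuousAt.preimage_mem_nhds
        (Metric.ball_mem_nhds _ (by norm_num))
    have h3 := (continuous_snd.comp hcont).continuousAt.preimage_mem_nhds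
      (x := pullbackParam hΦ y) h1
    filter_upwards [h2, h3] with q hq1 hq2
    obtain ⟨z, ⟨hzV, hzb⟩, hz⟩ := hq2
    suffices h : pullbackParam hΦ z = q by rw [← h]; exact hzV
    refine Subtype.ext (Prod.ext ?_ hz)
    have hq := q.2
    simp only [Function.comp_apply] at hz
    rw [← hz, torusProj_mk, Homeomorph.apply_symm_apply] at hq
    obtain ⟨t, ht⟩ := toTorus_eq_iff.1 hq
    change z.1 = q.1.1
    ext i
    have hd : dist (q.1.1 i) (z.1 i) < 1 := by
      refine (dist_le_pi_dist q.1.1 z.1 i).trans_lt ?_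
      have := dist_triangle_right q.1.1 z.1 y.1
      have h4 : dist q.1.1 y.1 < 1 / 2 := hq1
      have h5 : dist z.1 y.1 < 1 / 2 := hzb
      linarith
    rw [ht i, Real.dist_eq, add_sub_cancel_left] at hd
    have : |t i| < 1 := by exact_mod_cast hd
    rw [ht i, Int.abs_lt_one_iff.1 this, Int.cast_zero, add_zero]

/-- Group elements preserving the `ℝ^s` coordinate have shift zero, so they are lattice translations
and the fibre of the pull-back is `ℝ^N/ℤ^N`. -/
theorem pullbackParam_eq_iff (hΦ : ∀ (g : GroupD hD) x, Φ (g • x) = affineMap g (Φ x))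
    (y z : (Fin s → ℝ) × (Fin N → ℝ)) :
    Prod.map id toTorus y = Prod.map id toTorus z ↔
      pullbackParam hΦ y = pullbackParam hΦ z := by
  rw [Subtype.ext_iff, Prod.ext_iff, Prod.ext_iff]
  refine and_congr_right fun h1 => ?_
  change toTorus y.2 = toTorus z.2 ↔ Quotient.mk _ (Φ.symm y) = Quotient.mk _ (Φ.symm z)
  rw [eq_comm, quotient_mk_eq_iff_of_affine hΦ, toTorus_eq_iff]
  have h1' : y.1 = z.1 := h1
  constructor
  · rintro ⟨m, hm⟩
    refine ⟨translation hD m, Prod.ext ?_ ?_⟩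
    · ext i
      simp [affineMap, shift_translation, h1']
    · ext k
      simp [affineMap, shift_translation, vec_translation, hm]
  · rintro ⟨g, hg⟩
    have ht : g.shift = 1 := by
      ext i
      have := congrFun (congrArg Prod.fst hg) i
      simpa [affineMap, h1'] using this
    refine ⟨g.vec, fun k => ?_⟩
    rw [← hg]
    simp [affineMap, ht]

/-- `id × toTorus` and `pullbackParam` are open quotient maps of `ℝ^s × ℝ^N` with the same fibres,
so their targets are homeomorphic over `ℝ^s`. -/
theorem exists_trivialization (hΦ : ∀ (g : GroupD hD) x, Φ (g • x) = affineMap g (Φ x)) :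
    ∃ Θ : ((Fin s → ℝ) × UnitAddTorus (Fin N)) ≃ₜ
        {q : (Fin s → ℝ) × Quotient (MulAction.orbitRel (GroupD hD) X) //
          torusProj hΦ q.2 = toTorus q.1},
      (∀ c x, (Θ (c, x)).1.1 = c) ∧
      ∀ i c x, (Θ (c + Pi.single i 1, torusMap (monodromyMatrix hD i) x)).1.2 =
        (Θ (c, x)).1.2 := by
  obtain ⟨Θ, hΘ⟩ := exists_homeomorph_of_isOpenQuotientMap
    (IsOpenQuotientMap.id.prodMap (isOpenQuotientMap_toTorus (s := N)))
    (isOpenQuotientMap_pullbackParam hΦ) (pullbackParam_eq_iff hΦ)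
  refine ⟨Θ, fun c x => ?_, fun i c x => ?_⟩
  all_goals obtain ⟨r, rfl⟩ := isOpenQuotientMap_toTorus.surjective x
  · exact congrArg (fun q => q.1.1) (hΘ (c, r))
  · rw [torusMap_toTorus]
    refine (congrArg (fun q => q.1.2) (hΘ (c + Pi.single i 1, _))).trans
      (Eq.trans ?_ (congrArg (fun q => q.1.2) (hΘ (c, r))).symm)
    -- The point `(c + e_i, D_i(Mᵀ) r)` is the image of `(c, r)` under `τ_i`, so both have the same
    -- class.
    refine (quotient_mk_eq_iff_of_affine hΦ).2 ⟨tau hD i, Prod.ext ?_ ?_⟩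
    · ext j
      by_cases h : j = i
      · subst h; simp [affineMap, shift_tau]
      · simp [affineMap, shift_tau, h]
    · ext k
      simp [affineMap, shift_tau, vec_tau, monodromyRep_mulSingle]

theorem hasMonodromy_torusProj (hΦ : ∀ (g : GroupD hD) x, Φ (g • x) = affineMap g (Φ x)) :
    HasMonodromy (torusProj hΦ) fun i => torusMap (monodromyMatrix hD i) :=
  exists_trivialization hΦ

theorem isFibration_torusProj (hΦ : ∀ (g : GroupD hD) x, Φ (g • x) = affineMap g (Φ x)) :
    IsFibration (UnitAddTorus (Fin N)) (torusProj hΦ) := by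
  obtain ⟨Θ, hΘ, -⟩ := exists_trivialization hΦ
  exact isFibration_of_pullback (continuous_torusProj hΦ) Θ hΘ

end AffineModel

end GenOT

/-! ### The main theorem -/

theorem theorem5p1 {s n : ℕ} (hs : 0 < s)
    (M : Matrix.SpecialLinearGroup (Fin (s + 2 * n)) ℤ) (hM : GenOT.MatrixIsTypeJ M)
    (α : Fin s → ℝ) (hα : GenOT.IsRealSpectrum M α)
    (D : Fin s → Polynomial ℤ) (hD : GenOT.IsDirichletFamily M α D) :
    -- the choices needed for the construction can be made
    Nonempty (GenOT.Frame M α) ∧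
    -- and for every choice one has the following
    ∀ F : GenOT.Frame M α,
      ∃ _act : MulAction (GenOT.GroupD hD) (GenOT.HC s n),
        GenOT.IsTwistedDiagonal F hD ∧
        -- the action is by biholomorphisms, properly discontinuous and free
        (∀ g : GenOT.GroupD hD,
          ContMDiff 𝓘(ℂ, (Fin s → ℂ) × (Fin n → ℂ)) 𝓘(ℂ, (Fin s → ℂ) × (Fin n → ℂ)) ω
            (fun x : GenOT.HC s n => (g • x : GenOT.HC s n))) ∧
        ProperlyDiscontinuousSMul (GenOT.GroupD hD) (GenOT.HC s n) ∧
        (∀ (g : GenOT.GroupD hD) (x : GenOT.HC s n), g • x = x → g = 1) ∧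
        -- the quotient is a compact complex manifold of dimension `n + s`
        CompactSpace (GenOT.T (n := n) hD) ∧
        T2Space (GenOT.T (n := n) hD) ∧
        SecondCountableTopology (GenOT.T (n := n) hD) ∧
        Module.finrank ℂ ((Fin s → ℂ) × (Fin n → ℂ)) = n + s ∧
        (∃ _cs : ChartedSpace ((Fin s → ℂ) × (Fin n → ℂ)) (GenOT.T (n := n) hD),
          IsManifold 𝓘(ℂ, (Fin s → ℂ) × (Fin n → ℂ)) ω (GenOT.T (n := n) hD) ∧
          IsLocalDiffeomorph 𝓘(ℂ, (Fin s → ℂ) × (Fin n → ℂ))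
            𝓘(ℂ, (Fin s → ℂ) × (Fin n → ℂ)) ω (GenOT.toT (n := n) hD)) ∧
        -- the natural fibration over the torus, its fibre and its monodromy
        (∃ p : GenOT.T (n := n) hD → UnitAddTorus (Fin s),
          (∀ (x : GenOT.HC s n) (c : Fin s → ℝ),
            (∀ j, Real.log (x.1.1 j).im =
              ∑ i, c i * Real.log (Polynomial.aeval (α j) (D i))) →
            p (GenOT.toT hD x) = GenOT.toTorus c) ∧
          GenOT.IsFibration (UnitAddTorus (Fin (s + 2 * n))) p ∧
          GenOT.HasMonodromy p (fun i => GenOT.torusMap (GenOT.monodromyMatrix hD i))) ∧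
        -- the monodromy group is isomorphic to `ℤ^s`
        Function.Injective (GenOT.monodromyRep hD) := by
  refine ⟨GenOT.Frame.nonempty hM hα, fun F => ?_⟩
  let act := F.action hM hα hD
  have hΦ := F.coord_smul hM hα hD
  have hcont := GenOT.continuousConstSMul_of_affine hΦ
  have hpd := GenOT.properlyDiscontinuousSMul_of_affine hΦ
  have hfree : ∀ (g : GenOT.GroupD hD) (x : GenOT.HC s n), g • x = x → g = 1 :=
    fun g x h => GenOT.eq_one_of_affine hΦ h
  have hcancel : IsCancelSMul (GenOT.GroupD hD) (GenOT.HC s n) :=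
    isCancelSMul_iff_eq_one_of_smul_eq.2 hfree
  have hlc : LocallyCompactSpace (GenOT.HC s n) := (GenOT.HC s n).isOpen.locallyCompactSpace
  -- A free, properly discontinuous action on a locally compact Hausdorff space has a covering map
  -- as its quotient map.
  have hloc : IsLocalHomeomorph (GenOT.toT (n := n) hD) :=
    (isQuotientCoveringMap_quotientMk_of_properlyDiscontinuousSMul
      (G := GenOT.GroupD hD) (E := GenOT.HC s n)).isCoveringMap.isLocalHomeomorph
  have hdeck : ∀ x y, GenOT.toT (n := n) hD x = GenOT.toT hD y →
      ∃ γ : GenOT.HC s n → GenOT.HC s n,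
        ContMDiff 𝓘(ℂ, (Fin s → ℂ) × (Fin n → ℂ)) 𝓘(ℂ, (Fin s → ℂ) × (Fin n → ℂ)) ω γ ∧
          γ x = y ∧ ∀ z, GenOT.toT (n := n) hD (γ z) = GenOT.toT hD z := by
    intro x y hxy
    obtain ⟨g, hg⟩ := MulAction.orbitRel_apply.1 (Quotient.exact hxy.symm)
    exact ⟨fun z => g • z, F.contMDiff_smul hM hα hD g, hg,
      fun z => Quotient.sound (MulAction.orbitRel_apply.2 ⟨g, rfl⟩)⟩
  refine ⟨act, F.isTwistedDiagonal_action hM hα hD, F.contMDiff_smul hM hα hD, hpd, hfree,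
    GenOT.compactSpace_of_affine hΦ, inferInstance,
    ContinuousConstSMul.secondCountableTopology, ?_,
    ⟨hloc.chartedSpace Quotient.mk_surjective,
      hloc.isManifold_of_deck _ Quotient.mk_surjective hdeck,
      hloc.isLocalDiffeomorph_of_deck _ Quotient.mk_surjective hdeck⟩,
    ⟨GenOT.torusProj hΦ, fun x c hc => ?_, GenOT.isFibration_torusProj hΦ,
      GenOT.hasMonodromy_torusProj hΦ⟩, GenOT.monodromyRep_injective F hM hα hD⟩
  · rw [Module.finrank_prod, Module.finrank_fin_fun, Module.finrank_fin_fun, add_comm]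
  · exact (GenOT.torusProj_mk hΦ x).trans
      (congrArg GenOT.toTorus (F.coord_fst_eq hM hα hD hc))
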